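/- Let $p$ be a prime, let $L/K$ be a finite Galois extension of fields of characteristic $p$ with Galois group $\Gamma$, and let $G$ be a finite group. For a field $k\in\{K,L\}$ a block idempotent of a group algebra $kH$ is a primitive idempotent of its centre $Z(kH)$. The group $\Gamma$ acts on $LH$ through the coefficients, and for a block idempotent $c$ of $LH$ we write $\tilde c$ for the sum of the distinct $\Gamma$-conjugates of $c$, which is an element of $KH\subseteq LH$. For a $p$-subgroup $P$ of $G$ let $\mathrm{Br}_P\colon (kG)^P\to kC_G(P)$, $\sum_{g\in G}\alpha_g g\mapsto\sum_{g\in C_G(P)}\alpha_g g$, be the Brauer homomorphism. A $kG$-Brauer pair is a pair $(P,e)$ of a $p$-subgroup $P$ of $G$ and a block idempotent $e$ of $kC_G(P)$; for a block idempotent $b$ of $kG$ it is a $kGb$-Brauer pair if $\mathrm{Br}_P(b)e=e$. For Brauer pairs one writes $(Q,f)\le(P,e)$ if $Q\le P$ and every primitive idempotent $i$ of $(kG)^P$ with $e\,\mathrm{Br}_P(i)=\mathrm{Br}_P(i)\neq 0$ also satisfies $f\,\mathrm{Br}_Q(i)=\mathrm{Br}_Q(i)\ne 0$; maximal $kGb$-Brauer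 pairs are meant with respect to $\le$. The group $G$ acts on Brauer pairs by conjugation, ${}^x(P,e)=(xPx^{-1},xex^{-1})$. For a maximal $kGb$-Brauer pair $(P,e)$ and $Q\le P$ let $e_Q$ be the unique block idempotent of $kC_G(Q)$ with $(Q,e_Q)\le(P,e)$. The fusion system $\mathcal F_{(P,e)}(kGb)$ over $P$ is the category whose objects are the subgroups of $P$ and whose morphisms $Q\to R$ are the group homomorphisms $\varphi\colon Q\to R$ for which there is $x\in G$ with $\varphi(u)=xux^{-1}$ for all $u\in Q$ and ${}^x(Q,e_Q)\le(R,e_R)$, composed as maps. **Corollary.** Let $b$ be a block idempotent of $LG$ and let $(P,e)$ be a maximal $LGb$-Brauer pair. Then $\tilde b$ is a block idempotent of $KG$, the pair $(P,\tilde e)$ is a maximal $KG\tilde b$-Brauer pair, and there is an inclusion of fusion systems over $P$ $$\mathcal F_{(P,e)}(LGb)\subseteq\mathcal F_{(P,\tilde e)}(KG\tilde b)$$ which is the identity on objects and on morphisms; that is, both categories are fusion systems over $P$, and $\mathrm{Hom}_{\mathcal F_{(P,e)}(LGb)}(Q,R)\subseteq\mathrm{Hom}_{\mathcal F_{(P,\tilde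 e)}(KG\tilde b)}(Q,R)$ for all subgroups $Q,R$ of $P$. Here a category whose objects are the subgroups of $P$ and whose morphisms are group homomorphisms, composed as maps, is a fusion system over $P$ if all its morphisms are injective, every homomorphism $Q\to R$ of the form $u\mapsto xux^{-1}$ with $x\in P$ is a morphism, and for every morphism $\varphi\colon Q\to R$ the isomorphism $Q\to\varphi(Q)$ induced by $\varphi$ and its inverse are morphisms. -/

import Mathlib

noncomputable section

namespace BlockFusion

/-- A primitive idempotent of a ring: a nonzero idempotent which is not the sum of two nonzero
orthogonal idempotents. -/
def IsPrimitiveIdempotent {A : Type*} [Ring A] (e : A) : Prop :=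
  IsIdempotentElem e ∧ e ≠ 0 ∧
    ∀ f g : A, IsIdempotentElem f → IsIdempotentElem g → f * g = 0 → g * f = 0 →
      f + g = e → f = 0 ∨ g = 0

/-- A block idempotent of a ring (below: of a group algebra): a primitive idempotent of the
centre. -/
def IsBlockIdempotent {A : Type*} [Ring A] (e : A) : Prop :=
  ∃ h : e ∈ Subring.center A, IsPrimitiveIdempotent (⟨e, h⟩ : Subring.center A)

section Brauer

variable (k : Type*) [Field k] {G : Type*} [Group G]

/-- The `k`-algebra automorphism `c_x` of `kG` extending the conjugation `g ↦ x g x⁻¹`. -/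
def conjAlg (x : G) : MonoidAlgebra k G →ₐ[k] MonoidAlgebra k G :=
  MonoidAlgebra.mapDomainAlgHom k k (MulAut.conj x).toMonoidHom

/-- The algebra `(kG)^P` of fixed points of `P` on `kG` under conjugation. -/
def fixedAlg (P : Subgroup G) : Subalgebra k (MonoidAlgebra k G) where
  carrier := {a | ∀ x ∈ P, conjAlg k x a = a}
  mul_mem' := by
    intro a b ha hb x hx
    rw [map_mul, ha x hx, hb x hx]
  add_mem' := by
    intro a b ha hb x hx
    rw [map_add, ha x hx, hb x hx]
  algebraMap_mem' := by
    intro r x _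
    exact AlgHom.commutes _ r

/-- The group algebra `kC_G(P)`. -/
abbrev CentAlg (P : Subgroup G) : Type _ :=
  MonoidAlgebra k (Subgroup.centralizer (P : Set G))

variable {k}

/-- The Brauer map `∑_{g ∈ G} α_g g ↦ ∑_{g ∈ C_G(P)} α_g g` with values in `kC_G(P)`; it is used
on elements of `(kG)^P` only, where it is the Brauer homomorphism. -/
def brauerMap (P : Subgroup G) (a : MonoidAlgebra k G) : CentAlg k P :=
  MonoidAlgebra.comapDomain (Subtype.val : Subgroup.centralizer (P : Set G) → G)
    Subtype.val_injective a

/-- The conjugation map `C_G(P) → C_G(xPx⁻¹)`, `g ↦ x g x⁻¹`. -/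
def conjCentralizer (x : G) (P : Subgroup G) :
    Subgroup.centralizer (P : Set G) →*
      Subgroup.centralizer ((P.map (MulAut.conj x).toMonoidHom : Subgroup G) : Set G) where
  toFun g := ⟨x * g * x⁻¹, by
    rw [Subgroup.mem_centralizer_iff]
    rintro _ ⟨u, hu, rfl⟩
    have h := Subgroup.mem_centralizer_iff.mp g.2 u hu
    calc x * u * x⁻¹ * (x * g * x⁻¹) = x * (u * g) * x⁻¹ := by group
      _ = x * (g * u) * x⁻¹ := by rw [h]
      _ = x * g * x⁻¹ * (x * u * x⁻¹) := by group⟩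
  map_one' := by ext; simp
  map_mul' a b := by
    apply Subtype.ext
    change x * (a * b : G) * x⁻¹ = x * a * x⁻¹ * (x * b * x⁻¹)
    group

variable (k G)

/-- A subgroup `P` of `G` with an element of `kC_G(P)` (the raw data of a Brauer pair). -/
structure Pair where
  /-- the subgroup `P` -/
  subgroup : Subgroup G
  /-- the element of `kC_G(P)` -/
  elem : CentAlg k subgroup

variable {k G}

/-- An element `i` (below: a primitive idempotent of `(kG)^P`) is associated to the pair `(P, e)`
if `e Br_P(i) = Br_P(i) ≠ 0`. -/
def Pair.Associated (X : Pair k G) (i : MonoidAlgebra k G) : Prop :=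
  X.elem * brauerMap X.subgroup i = brauerMap X.subgroup i ∧ brauerMap X.subgroup i ≠ 0

/-- `(Q, f) ≤ (P, e)`: one has `Q ≤ P`, and every primitive idempotent of `(kG)^P` which is
associated to `(P, e)` is also associated to `(Q, f)`. -/
instance : LE (Pair k G) where
  le Y X := Y.subgroup ≤ X.subgroup ∧
    ∀ i : fixedAlg k X.subgroup, IsPrimitiveIdempotent i →
      X.Associated (i : MonoidAlgebra k G) → Y.Associated (i : MonoidAlgebra k G)

/-- The conjugate pair `ˣ(P, e) = (xPx⁻¹, x e x⁻¹)`. -/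
def Pair.conj (x : G) (X : Pair k G) : Pair k G where
  subgroup := X.subgroup.map (MulAut.conj x).toMonoidHom
  elem := MonoidAlgebra.mapDomainRingHom k (conjCentralizer x X.subgroup) X.elem

/-- `(P, e)` is a `kG`-Brauer pair: `P` is a `p`-subgroup of `G` and `e` is a block idempotent of
`kC_G(P)`. -/
def Pair.IsBrauerPair (p : ℕ) (X : Pair k G) : Prop :=
  IsPGroup p X.subgroup ∧ IsBlockIdempotent X.elem

/-- The set of `kGb`-Brauer pairs: the `kG`-Brauer pairs `(P, e)` with `Br_P(b) e = e`. -/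
def brauerPairs (p : ℕ) (b : MonoidAlgebra k G) : Set (Pair k G) :=
  {X | X.IsBrauerPair p ∧ brauerMap X.subgroup b * X.elem = X.elem}

/-- `(P, e)` is a maximal `kGb`-Brauer pair: a maximal element of the set of `kGb`-Brauer pairs. -/
def IsMaximalBrauerPair (p : ℕ) (b : MonoidAlgebra k G) (X : Pair k G) : Prop :=
  Maximal (fun Y => Y ∈ brauerPairs p b) X

/-- `f = e_Q` with respect to `(P, e)`: `f` is a block idempotent of `kC_G(Q)` such that
`(Q, f) ≤ (P, e)`. For a Brauer pair `(P, e)` and `Q ≤ P` there is exactly one such `f`. -/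
def IsBlockBelow (X : Pair k G) (Q : Subgroup G) (f : CentAlg k Q) : Prop :=
  IsBlockIdempotent f ∧ (⟨Q, f⟩ : Pair k G) ≤ X

/-- The morphism sets of the category `ℱ_{(P,e)}(kGb)`, whose objects are the subgroups of `P`:
the homomorphisms `φ : Q → R` for which there is `x ∈ G` with `φ(u) = x u x⁻¹` for all `u ∈ Q`
and `ˣ(Q, e_Q) ≤ (R, e_R)`. (The block idempotent `b` is determined by `(P, e)`.) -/
def fusionHom (X : Pair k G) (Q R : Subgroup X.subgroup) : Set (Q →* R) :=
  {φ | ∃ x : G, (∀ u : Q, ((φ u : X.subgroup) : G) = x * ((u : X.subgroup) : G) * x⁻¹) ∧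
    ∃ (f : CentAlg k (Q.map X.subgroup.subtype)) (g : CentAlg k (R.map X.subgroup.subtype)),
      IsBlockBelow X (Q.map X.subgroup.subtype) f ∧
      IsBlockBelow X (R.map X.subgroup.subtype) g ∧
      Pair.conj x ⟨Q.map X.subgroup.subtype, f⟩ ≤ ⟨R.map X.subgroup.subtype, g⟩}

end Brauer

/-- The sets `Hom Q R` of group homomorphisms between subgroups of `P` are the morphism sets of a
fusion system over `P` (with the usual composition of maps). -/
structure IsFusionSystem {P : Type*} [Group P] (Hom : ∀ Q R : Subgroup P, Set (Q →* R)) :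
    Prop where
  /-- identities are morphisms -/
  id_mem : ∀ Q : Subgroup P, MonoidHom.id Q ∈ Hom Q Q
  /-- composites of morphisms are morphisms -/
  comp_mem : ∀ (Q R S : Subgroup P) (φ : Q →* R) (ψ : R →* S),
    φ ∈ Hom Q R → ψ ∈ Hom R S → ψ.comp φ ∈ Hom Q S
  /-- homomorphisms induced by conjugation with an element of `P` are morphisms -/
  conj_mem : ∀ (Q R : Subgroup P) (φ : Q →* R) (x : P),
    (∀ u : Q, (φ u : P) = x * (u : P) * x⁻¹) → φ ∈ Hom Q R
  /-- morphisms are injective -/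
  injective : ∀ (Q R : Subgroup P) (φ : Q →* R), φ ∈ Hom Q R → Function.Injective φ
  /-- for a morphism `φ` the isomorphism `Q → φ(Q)` and its inverse are morphisms -/
  iso_mem : ∀ (Q R : Subgroup P) (φ : Q →* R), φ ∈ Hom Q R →
    ∃ ψ : Q ≃* (φ.range.map R.subtype : Subgroup P), (∀ u : Q, (ψ u : P) = (φ u : P)) ∧
      ψ.toMonoidHom ∈ Hom Q (φ.range.map R.subtype) ∧
      ψ.symm.toMonoidHom ∈ Hom (φ.range.map R.subtype) Q

section Descent

variable (K : Type*) {L : Type*} [Field K] [Field L] [Algebra K L] {H : Type*} [Group H]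

/-- The action of `γ ∈ Gal(L/K)` on the coefficients of elements of `LH`. -/
def galConj {K : Type*} {L : Type*} [Field K] [Field L] [Algebra K L] {H : Type*} [Group H]
    (γ : L ≃ₐ[K] L) : MonoidAlgebra L H →+* MonoidAlgebra L H :=
  MonoidAlgebra.mapRingHom H (γ : L →+* L)

open scoped Classical in
/-- The sum of the distinct `Gal(L/K)`-conjugates of `b`, an element of `LH`. -/
def galOrbitSum [FiniteDimensional K L] (b : MonoidAlgebra L H) : MonoidAlgebra L H :=
  ∑ c ∈ (Finset.univ : Finset (L ≃ₐ[K] L)).image (fun γ => galConj γ b), c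

variable [FiniteDimensional K L]

theorem galConj_galOrbitSum (γ : L ≃ₐ[K] L) (b : MonoidAlgebra L H) :
    galConj γ (galOrbitSum K b) = galOrbitSum K b := by
  classical
  have hcomp : ∀ (σ τ : L ≃ₐ[K] L) (a : MonoidAlgebra L H),
      galConj σ (galConj τ a) = galConj (σ * τ) a := by
    intro σ τ a
    ext m
    simp [galConj]
  have hone : ∀ a : MonoidAlgebra L H, galConj (1 : L ≃ₐ[K] L) a = a := by
    intro a
    ext m
    simp [galConj]
  unfold galOrbitSum
  rw [map_sum]
  refine Finset.sum_bij' (fun a _ => galConj γ a) (fun a _ => galConj γ⁻¹ a) ?_ ?_ ?_ ?_ ?_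
  · intro a ha
    obtain ⟨σ, -, rfl⟩ := Finset.mem_image.mp ha
    exact Finset.mem_image.mpr ⟨γ * σ, Finset.mem_univ _, (hcomp _ _ _).symm⟩
  · intro a ha
    obtain ⟨σ, -, rfl⟩ := Finset.mem_image.mp ha
    exact Finset.mem_image.mpr ⟨γ⁻¹ * σ, Finset.mem_univ _, (hcomp _ _ _).symm⟩
  · intro a _
    rw [hcomp, inv_mul_cancel, hone]
  · intro a _
    rw [hcomp, mul_inv_cancel, hone]
  · intro a _
    rfl

/-- The orbit sum has its coefficients in `K`, i.e. it lies in `KH ⊆ LH`. -/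
theorem exists_map_eq_galOrbitSum [IsGalois K L] (b : MonoidAlgebra L H) :
    ∃ c : MonoidAlgebra K H,
      MonoidAlgebra.mapRingHom H (algebraMap K L) c = galOrbitSum K b := by
  classical
  have hfix : ∀ m : H, ∃ y : K, algebraMap K L y = (galOrbitSum K b).coeff m := by
    intro m
    refine (IsGalois.mem_range_algebraMap_iff_fixed (F := K) (E := L) _).mpr fun γ => ?_
    have h := congrArg (fun a => a.coeff m) (galConj_galOrbitSum K γ b)
    simpa [galConj] using h
  choose y hy using hfix
  refine ⟨MonoidAlgebra.ofCoeff (Finsupp.onFinset (galOrbitSum K b).coeff.support y ?_), ?_⟩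
  · intro m hm
    rw [Finsupp.mem_support_iff, ← hy m]
    simpa using hm
  · ext m
    simp [hy]

/-- The element `b̃` of `KH` which, as an element of `LH`, is the sum of the distinct
`Gal(L/K)`-conjugates of `b`. -/
def tilde [IsGalois K L] (b : MonoidAlgebra L H) : MonoidAlgebra K H :=
  (exists_map_eq_galOrbitSum K b).choose

theorem tilde_spec [IsGalois K L] (b : MonoidAlgebra L H) :
    MonoidAlgebra.mapRingHom H (algebraMap K L) (tilde K b) = galOrbitSum K b :=
  (exists_map_eq_galOrbitSum K b).choose_spec

end Descent

end BlockFusion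

end

noncomputable section

namespace BlockFusion

/-! ### Primitive and block idempotents of finite-dimensional algebras -/

section RingTheory

variable {A : Type*} [Ring A]

/-! Descent of blocks is elementary. A central idempotent of `KH`, read in `LH`, is central and
Galois invariant, so it fixes every conjugate of a block `b` of `LH` or kills every one. Hence `b̃`
is a block, and it is the only block of `KH` that does not annihilate `b`
(`isBlockIdempotent_tilde`, `eq_tilde_of_mul_ne_zero`).

The core is that for a Brauer pair `(P, e)` and `Q ≤ P` a block `e_Q` below `e` exists
(`exists_block_le`); it is unique because two blocks fixing the same nonzero `Br_Q(i)` coincide.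
Existence is by downward induction on `Q`. With `R = N_P(Q)` and `(R, g)` already found, let `f` be
an `R`-stable block of `kC_G(Q)` with `Br_R(f) g = g`. For a primitive `i` associated to `(P, e)`,
the idempotent `w = (1 - f) Br_Q(i)` dies under `Br_S` for all `Q < S ≤ R`. It therefore lifts to
some `a` in `(kG)^P` with `Br_P(a) = 0`. If `w ≠ 0`, then `iai` is not nilpotent, so it is right
invertible in the corner at `i`, and applying `Br_P` gives `Br_P(i) = 0`, a contradiction. Existence
and uniqueness make `≤` transitive and yield the fusion system axioms.

The two meet in `tilde_le_tilde`: `(Q, f) ≤ (P, e)` over `L` implies `(Q, f̃) ≤ (P, ẽ)` over `K`.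
The block of `KC_G(Q)` below `ẽ` and the block `f` both fix a common nonzero `Br_Q(j)`, so the
former is `f̃`. The inclusion of fusion systems follows with the same conjugating element. For
maximality, a pair above `(P, ẽ)` has the form `(R, ẽ')`, and a Galois conjugate of `(R, e')` lies
above `(P, e)`. -/

theorem IsPrimitiveIdempotent.eq_zero_or_eq {i : A} (hi : IsPrimitiveIdempotent i) {z : A}
    (hz : IsIdempotentElem z) (h1 : i * z = z) (h2 : z * i = z) : z = 0 ∨ z = i := by
  have hii : i * i = i := hi.1
  have hzz : z * z = z := hz
  refine (hi.2.2 z (i - z) hz ?_ ?_ ?_ ?_).imp id fun h => (sub_eq_zero.mp h).symm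
  · change (i - z) * (i - z) = i - z
    rw [mul_sub, sub_mul, sub_mul, hii, h1, h2, hzz, sub_self, sub_zero]
  · rw [mul_sub, h2, hzz, sub_self]
  · rw [sub_mul, h1, hzz, sub_self]
  · abel

/-- Below an idempotent on which an additive map does not vanish there is a primitive idempotent
on which it does not vanish. -/
theorem exists_primitive_le_of_map_ne_zero [IsArtinianRing A] {M : Type*} [AddCommGroup M]
    (T : A →+ M) {i : A} (hi : IsIdempotentElem i) (hT : T i ≠ 0) :
    ∃ j : A, IsPrimitiveIdempotent j ∧ i * j = j ∧ j * i = j ∧ T j ≠ 0 := by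
  suffices H : ∀ I : Submodule A A, ∀ i : A, Submodule.span A {i} = I → IsIdempotentElem i →
      T i ≠ 0 → ∃ j : A, IsPrimitiveIdempotent j ∧ i * j = j ∧ j * i = j ∧ T j ≠ 0 from
    H _ i rfl hi hT
  intro I
  -- The left ideal `Ai` is the induction variable: if `i = f + g` is a proper orthogonal splitting,
  -- then `Af` and `Ag` are strictly smaller, and `T` is nonzero on one of the summands.
  induction I using WellFoundedLT.induction with
  | _ I ih =>
  rintro i rfl hi hT
  have hii : i * i = i := hi
  by_cases hp : IsPrimitiveIdempotent i
  · exact ⟨i, hp, hi, hi, hT⟩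
  have hne : i ≠ 0 := by
    rintro rfl
    exact hT (map_zero T)
  simp only [IsPrimitiveIdempotent, not_and, not_forall, not_or] at hp
  obtain ⟨f, g, hf, hg, hfg, hgf, hsum, hf0, hg0⟩ := hp hi hne
  have key : ∀ f g : A, IsIdempotentElem f → IsIdempotentElem g → f * g = 0 → g * f = 0 →
      f + g = i → g ≠ 0 → T f ≠ 0 →
      ∃ j : A, IsPrimitiveIdempotent j ∧ i * j = j ∧ j * i = j ∧ T j ≠ 0 := by
    intro f g hf hg hfg hgf hsum hg0 hTf
    have hff : f * f = f := hf
    have hgg : g * g = g := hg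
    have hfi : f * i = f := by rw [← hsum, mul_add, hff, hfg, add_zero]
    have hif : i * f = f := by rw [← hsum, add_mul, hff, hgf, add_zero]
    have hlt : Submodule.span A {f} < Submodule.span A {i} := by
      refine lt_of_le_of_ne ?_ ?_
      · rw [Submodule.span_singleton_le_iff_mem, Submodule.mem_span_singleton]
        exact ⟨f, hfi⟩
      · intro h
        have : i ∈ Submodule.span A {f} := h ▸ Submodule.mem_span_singleton_self i
        obtain ⟨c, hc⟩ := Submodule.mem_span_singleton.mp this
        apply hg0
        have hig : i * g = g := by rw [← hsum, add_mul, hgg, hfg, zero_add]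
        rw [← hig, ← hc, smul_eq_mul, mul_assoc, hfg, mul_zero]
    obtain ⟨j, hj, h1, h2, h3⟩ := ih _ hlt f rfl hf hTf
    refine ⟨j, hj, ?_, ?_, h3⟩
    · rw [← h1, ← mul_assoc, hif]
    · rw [← h2, mul_assoc, hfi]
  by_cases hTf : T f = 0
  · refine key g f hg hf hgf hfg (by rw [add_comm, hsum]) hf0 fun h => hT ?_
    rw [← hsum, map_add, hTf, h, add_zero]
  · exact key f g hf hg hfg hgf hsum hg0 hTf

/-- In a corner `iAi` at a primitive idempotent every element is nilpotent or right invertible. -/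
theorem IsPrimitiveIdempotent.isNilpotent_or_exists_mul_eq (k : Type*) [Field k] [Algebra k A]
    [FiniteDimensional k A] {i : A} (hi : IsPrimitiveIdempotent i) {a : A}
    (h1 : i * a = a) (h2 : a * i = a) : IsNilpotent a ∨ ∃ c, a * c = i := by
  classical
  have hint : IsIntegral k a := IsIntegral.of_finite k a
  -- Fitting's lemma read off from the minimal polynomial `X ^ n * q` with `q` prime to `X`: a
  -- Bézout relation produces the idempotent projecting onto the part where `a` is invertible.
  obtain ⟨q, hq, hnd⟩ := Polynomial.exists_eq_pow_rootMultiplicity_mul_and_not_dvd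
    (minpoly k a) (minpoly.ne_zero hint) 0
  set n := (minpoly k a).rootMultiplicity 0
  rw [Polynomial.C_0, sub_zero] at hq hnd
  -- The exponent is `n + 1` rather than `n` so that `z` below has a factor `a` even when `n = 0`;
  -- this puts `z` in the corner `iAi`.
  have hcop : IsCoprime (Polynomial.X ^ (n + 1) : Polynomial k) q :=
    IsCoprime.pow_left ((Polynomial.prime_X.irreducible.coprime_iff_not_dvd).mpr hnd)
  obtain ⟨u, v, huv⟩ := hcop
  set ev := Polynomial.aeval (R := k) a
  have hX : ev Polynomial.X = a := Polynomial.aeval_X a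
  have hcomm : ∀ r s : Polynomial k, ev r * ev s = ev s * ev r := fun r s => by
    rw [← map_mul, mul_comm, map_mul]
  have hzero : a ^ n * ev q = 0 := by
    rw [← hX, ← map_pow, ← map_mul, ← hq]
    exact minpoly.aeval k a
  have hstab : a ^ (n + 1) = a ^ (n + 1) * (a ^ (n + 1) * ev u) := by
    have := congrArg ev huv
    rw [map_add, map_mul, map_mul, map_one, map_pow, hX] at this
    have hau : ev u * a ^ (n + 1) = a ^ (n + 1) * ev u := by
      rw [← hX, ← map_pow, hcomm]
    have hz : a ^ (n + 1) * (ev v * ev q) = 0 := by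
      rw [hcomm v q, ← mul_assoc, pow_succ', mul_assoc a, hzero, mul_zero, zero_mul]
    calc a ^ (n + 1) = a ^ (n + 1) * (ev u * a ^ (n + 1) + ev v * ev q) := by rw [this, mul_one]
      _ = _ := by rw [mul_add, hz, add_zero, hau]
  have hia : i * a ^ (n + 1) = a ^ (n + 1) := by rw [pow_succ', ← mul_assoc, h1]
  have hai : a ^ (n + 1) * i = a ^ (n + 1) := by rw [pow_succ, mul_assoc, h2]
  have hau : ev u * a ^ (n + 1) = a ^ (n + 1) * ev u := by
    rw [← hX, ← map_pow, hcomm]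
  set z := a ^ (n + 1) * ev u with hz
  have hcz : ev u * z = z * ev u := by
    rw [hz, ← mul_assoc, hau]
  have hzz : IsIdempotentElem z := by
    change z * z = z
    have : z * z = a ^ (n + 1) * z * ev u := by
      nth_rewrite 1 [hz]
      rw [mul_assoc, hcz, ← mul_assoc]
    rw [this, ← hstab]
  rcases hi.eq_zero_or_eq hzz (by rw [hz, ← mul_assoc, hia])
    (by rw [← hau, mul_assoc, hai]) with h | h
  · left
    refine ⟨n + 1, ?_⟩
    rw [hstab, h, mul_zero]
  · right
    refine ⟨a ^ n * ev u, ?_⟩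
    rw [← mul_assoc, ← pow_succ', ← h]

/-- The image of `iai` is a nonzero idempotent, so `iai` cannot be nilpotent. This substitutes for
lifting idempotents along `φ`. -/
theorem IsPrimitiveIdempotent.exists_mul_mul_eq (k : Type*) [Field k] [Algebra k A]
    [FiniteDimensional k A] {B : Type*} [Ring B] (φ : A →+* B) {i : A}
    (hi : IsPrimitiveIdempotent i) {a : A} (hz : IsIdempotentElem (φ a * φ i))
    (hcomm : φ a * φ i = φ i * φ a) (h0 : φ a * φ i ≠ 0) :
    ∃ c, i * a * i * c = i := by
  have hii : i * i = i := hi.1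
  have hφ : φ (i * a * i) = φ a * φ i := by
    rw [map_mul, map_mul, ← hcomm, mul_assoc, ← map_mul φ i i, hii]
  rcases hi.isNilpotent_or_exists_mul_eq k (a := i * a * i)
    (by simp only [← mul_assoc, hii]) (by rw [mul_assoc, hii]) with ⟨n, hn⟩ | h
  · exfalso
    apply h0
    have h := congrArg φ hn
    rw [map_pow, hφ, map_zero] at h
    have h' := hz.pow_succ_eq n
    rw [← h', pow_succ, h, zero_mul]
  · exact h

/-- The image of a primitive idempotent under a ring homomorphism lies below or is orthogonal to
every central idempotent in the range. -/
theorem IsPrimitiveIdempotent.map_mul_eq_zero_or_eq (k : Type*) [Field k] [Algebra k A]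
    [FiniteDimensional k A] {B : Type*} [Ring B] (φ : A →+* B) {i : A}
    (hi : IsPrimitiveIdempotent i) {a : A} (hz : IsIdempotentElem (φ a))
    (hcomm : φ a * φ i = φ i * φ a) : φ a * φ i = 0 ∨ φ a * φ i = φ i := by
  by_cases h0 : φ a * φ i = 0
  · exact Or.inl h0
  right
  have hii : φ i * φ i = φ i := by rw [← map_mul]; exact congrArg φ hi.1
  obtain ⟨c, hc⟩ := hi.exists_mul_mul_eq k φ (a := a)
    (by change _ = _; rw [hcomm, mul_assoc, ← mul_assoc (φ a) (φ i), hcomm,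
          mul_assoc (φ i) (φ a) (φ a), show φ a * φ a = φ a from hz, ← mul_assoc, hii]) hcomm h0
  have h : φ a * φ i * φ c = φ i := by
    have h := congrArg φ hc
    simp only [map_mul] at h
    rwa [← hcomm, mul_assoc (φ a) (φ i) (φ i), hii] at h
  calc φ a * φ i = φ a * (φ a * φ i * φ c) := congrArg (φ a * ·) h.symm
    _ = φ a * φ a * φ i * φ c := by simp only [mul_assoc]
    _ = φ i := by rw [show φ a * φ a = φ a from hz, h]

theorem IsBlockIdempotent.isIdempotentElem {e : A} (h : IsBlockIdempotent e) :
    IsIdempotentElem e := by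
  obtain ⟨hc, hp⟩ := h
  exact congrArg Subtype.val hp.1

theorem IsBlockIdempotent.ne_zero {e : A} (h : IsBlockIdempotent e) : e ≠ 0 := by
  obtain ⟨hc, hp⟩ := h
  exact fun h0 => hp.2.1 (Subtype.ext h0)

theorem IsBlockIdempotent.comm {e : A} (h : IsBlockIdempotent e) (a : A) : e * a = a * e :=
  (Subring.mem_center_iff.mp h.1 a).symm

/-- Primitivity in the centre becomes a test against central idempotents `z` of the whole ring: `ze`
and `e - ze` split `e`. All later arguments about blocks use this dichotomy. -/
theorem isBlockIdempotent_iff {e : A} : IsBlockIdempotent e ↔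
    (∀ a, e * a = a * e) ∧ IsIdempotentElem e ∧ e ≠ 0 ∧
      ∀ z, (∀ a, z * a = a * z) → IsIdempotentElem z → z * e = 0 ∨ z * e = e := by
  constructor
  · intro h
    refine ⟨h.comm, h.isIdempotentElem, h.ne_zero, fun z hz hzz => ?_⟩
    have hee : e * e = e := h.isIdempotentElem
    obtain ⟨hc, hp⟩ := h
    have hzc : z * e ∈ Subring.center A :=
      mul_mem (Subring.mem_center_iff.mpr fun a => (hz a).symm) hc
    refine (hp.eq_zero_or_eq (z := ⟨z * e, hzc⟩) ?_ ?_ ?_).imp (congrArg Subtype.val)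
      (congrArg Subtype.val)
    · apply Subtype.ext
      change z * e * (z * e) = z * e
      rw [mul_assoc, ← mul_assoc e z e, ← hz e, mul_assoc, ← mul_assoc, hee,
        show z * z = z from hzz]
    · apply Subtype.ext
      change e * (z * e) = z * e
      rw [← mul_assoc, ← hz e, mul_assoc, hee]
    · apply Subtype.ext
      change z * e * e = z * e
      rw [mul_assoc, hee]
  · rintro ⟨hc, hi, h0, hz⟩
    refine ⟨Subring.mem_center_iff.mpr fun a => (hc a).symm, Subtype.ext hi,
      fun h => h0 (congrArg Subtype.val h), ?_⟩
    rintro ⟨f, hf⟩ ⟨g, hg⟩ hff hgg hfg hgf hsum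
    replace hff : f * f = f := congrArg Subtype.val hff
    replace hfg : f * g = 0 := congrArg Subtype.val hfg
    replace hsum : f + g = e := congrArg Subtype.val hsum
    have hfe : f * e = f := by rw [← hsum, mul_add, hff, hfg, add_zero]
    rcases hz f (fun a => (Subring.mem_center_iff.mp hf a).symm) hff with h | h
    · exact Or.inl (Subtype.ext (hfe.symm.trans h))
    · refine Or.inr (Subtype.ext ?_)
      rw [hfe] at h
      change g = 0
      rw [h] at hsum
      exact left_eq_add.mp hsum.symm

theorem IsBlockIdempotent.mul_eq_zero_or_eq {e : A} (h : IsBlockIdempotent e) {z : A}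
    (hz : ∀ a, z * a = a * z) (hzz : IsIdempotentElem z) : z * e = 0 ∨ z * e = e :=
  (isBlockIdempotent_iff.mp h).2.2.2 z hz hzz

theorem IsBlockIdempotent.eq_of_mul_ne_zero {e f : A} (he : IsBlockIdempotent e)
    (hf : IsBlockIdempotent f) (h : e * f ≠ 0) : e = f := by
  have h1 := (hf.mul_eq_zero_or_eq he.comm he.isIdempotentElem).resolve_left h
  rw [he.comm] at h h1
  have h2 := (he.mul_eq_zero_or_eq hf.comm hf.isIdempotentElem).resolve_left h
  rw [← h2, h1]

theorem IsBlockIdempotent.mul_eq_zero {e f : A} (he : IsBlockIdempotent e)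
    (hf : IsBlockIdempotent f) (h : e ≠ f) : e * f = 0 := by
  by_contra h0
  exact h (he.eq_of_mul_ne_zero hf h0)

theorem IsBlockIdempotent.eq_of_mul_eq {e f i : A} (he : IsBlockIdempotent e)
    (hf : IsBlockIdempotent f) (hi : i ≠ 0) (h1 : e * i = i) (h2 : f * i = i) : e = f := by
  refine he.eq_of_mul_ne_zero hf fun h => hi ?_
  rw [← h1, ← h2, ← mul_assoc, h, zero_mul]

theorem IsBlockIdempotent.map_equiv {B : Type*} [Ring B] (φ : A ≃+* B) {e : A}
    (h : IsBlockIdempotent e) : IsBlockIdempotent (φ e) := by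
  rw [isBlockIdempotent_iff] at h ⊢
  obtain ⟨h1, h2, h3, h4⟩ := h
  refine ⟨fun a => ?_, ?_, ?_, fun z hz hzz => ?_⟩
  · apply φ.symm.injective
    simp [h1]
  · exact h2.map φ
  · simpa using h3
  · refine (h4 (φ.symm z) (fun a => ?_) (hzz.map φ.symm)).imp (fun h => ?_) (fun h => ?_)
    · apply φ.injective
      simp [hz]
    · apply φ.symm.injective
      simpa using h
    · apply φ.symm.injective
      simpa using h

variable (k : Type*) [Field k] [Algebra k A] [FiniteDimensional k A]

include k in
theorem isArtinianRing_center : IsArtinianRing (Subring.center A) := by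
  have : IsArtinianRing (Subalgebra.center k A) := IsArtinianRing.of_finite k _
  let f : Subalgebra.center k A →+* Subring.center A :=
    { toFun := fun x => ⟨x.1, x.2⟩
      map_one' := rfl
      map_mul' := fun _ _ => rfl
      map_zero' := rfl
      map_add' := fun _ _ => rfl }
  exact Function.Surjective.isArtinianRing (f := f) fun x => ⟨⟨x.1, x.2⟩, rfl⟩

include k in
-- Splitting `1` inside the Artinian centre, while keeping multiplication by `i` nonzero, ends at a
-- block.
theorem exists_block_mul_ne_zero {i : A} (hi : i ≠ 0) :
    ∃ e : A, IsBlockIdempotent e ∧ e * i ≠ 0 := by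
  have := isArtinianRing_center (A := A) k
  obtain ⟨j, hj, -, -, h⟩ := exists_primitive_le_of_map_ne_zero
    ((AddMonoidHom.mulRight i).comp (Subring.center A).subtype.toAddMonoidHom)
    (i := 1) IsIdempotentElem.one (by simpa using hi)
  exact ⟨j.1, ⟨j.2, hj⟩, by simpa using h⟩

include k in
-- Distinct blocks are orthogonal and nonzero, hence linearly independent.
theorem finite_setOf_isBlockIdempotent : {e : A | IsBlockIdempotent e}.Finite := by
  have : LinearIndependent k (Subtype.val : {e : A | IsBlockIdempotent e} → A) := by
    rw [linearIndependent_iff']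
    intro s g hg e hes
    have h := congrArg (· * e.1) hg
    simp only [Finset.sum_mul, zero_mul, smul_mul_assoc] at h
    rw [Finset.sum_eq_single e] at h
    · rw [show e.1 * e.1 = e.1 from e.2.isIdempotentElem] at h
      exact (smul_eq_zero.mp h).resolve_right e.2.ne_zero
    · intro f _ hfe
      rw [f.2.mul_eq_zero e.2 fun h => hfe (Subtype.ext h), smul_zero]
    · exact fun h => absurd hes h
  exact this.setFinite

include k in
theorem sum_blocks_eq_one :
    ∑ e ∈ (finite_setOf_isBlockIdempotent (A := A) k).toFinset, e = 1 := by
  by_contra hne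
  obtain ⟨e, he, h⟩ := exists_block_mul_ne_zero k (sub_ne_zero.mpr (Ne.symm hne))
  apply h
  rw [mul_sub, mul_one, Finset.mul_sum, Finset.sum_eq_single e, he.isIdempotentElem, sub_self]
  · intro f hf hfe
    have hf' : IsBlockIdempotent f := by simpa using hf
    exact he.mul_eq_zero hf' hfe.symm
  · intro hn
    simp [he] at hn

end RingTheory

/-! ### Fixed points of `p`-groups -/

section FixedPoints

open scoped Classical in
/-- A sum of an invariant function with values in characteristic `p` over a finite set with an
action of a `p`-group is the sum over the fixed points. -/
theorem sum_eq_sum_fixed {p : ℕ} [Fact p.Prime] {Γ α M : Type*} [Group Γ] [Finite Γ]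
    (hΓ : IsPGroup p Γ) [MulAction Γ α] [AddCommMonoid M] (hM : ∀ m : M, p • m = 0)
    (s : Finset α) (hs : ∀ (γ : Γ), ∀ a ∈ s, γ • a ∈ s) (F : α → M)
    (hF : ∀ (γ : Γ), ∀ a ∈ s, F (γ • a) = F a) :
    ∑ a ∈ s, F a = ∑ a ∈ s with ∀ γ : Γ, γ • a = a, F a := by
  rw [← Finset.sum_filter_add_sum_filter_not s (fun a => ∀ γ : Γ, γ • a = a)]
  suffices h : ∑ a ∈ s with ¬ ∀ γ : Γ, γ • a = a, F a = 0 by rw [h, add_zero]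
  refine Finset.sum_cancels_of_partition_cancels (MulAction.orbitRel Γ α) fun a ha => ?_
  rw [Finset.mem_filter] at ha
  have hset : ((Finset.filter (fun b => (MulAction.orbitRel Γ α) b a)
      (s.filter fun a => ¬ ∀ γ : Γ, γ • a = a) : Finset α) : Set α) = MulAction.orbit Γ a := by
    ext b
    simp only [Finset.coe_filter, Finset.mem_filter, Set.mem_ofPred_eq, MulAction.orbitRel_apply]
    refine ⟨fun h => h.2, fun h => ⟨?_, h⟩⟩
    obtain ⟨γ, rfl⟩ := h
    refine ⟨hs γ a ha.1, fun h => ha.2 fun δ => ?_⟩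
    have h1 := h (γ * δ * γ⁻¹)
    simp only [smul_smul, inv_mul_cancel_right] at h1
    rw [mul_smul] at h1
    exact MulAction.injective γ h1
  rw [Finset.sum_congr rfl (g := fun _ => F a), Finset.sum_const]
  · rw [← Set.ncard_coe_finset, hset, ← Nat.card_coe_set_eq]
    have : Finite (MulAction.orbit Γ a) := Set.finite_range _
    obtain ⟨n, hn⟩ := hΓ.card_orbit a
    rw [hn]
    -- An orbit of length `p ^ 0` would make `a` a fixed point, which the filter excludes; every
    -- other orbit length is divisible by `p`.
    rcases n with _ | n
    · exfalso
      apply ha.2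
      intro γ
      rw [pow_zero, Nat.card_eq_one_iff_unique] at hn
      have := hn.1
      exact congrArg Subtype.val (Subsingleton.elim
        (⟨γ • a, MulAction.mem_orbit a γ⟩ : MulAction.orbit Γ a) ⟨a, MulAction.mem_orbit_self a⟩)
    · rw [pow_succ, mul_smul, hM, smul_zero]
  · intro b hb
    have hb' : b ∈ MulAction.orbit Γ a := by
      rw [← hset]
      exact hb
    obtain ⟨γ, rfl⟩ := hb'
    exact hF γ a ha.1

/-- A proper subgroup `Q` of a `p`-subgroup `T` is normalized by an element of `T` outside `Q`. -/
theorem exists_mem_normalizer_notMem {p : ℕ} [Fact p.Prime] {G : Type*} [Group G] [Finite G]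
    {Q T : Subgroup G} (hT : IsPGroup p T) (hQT : Q < T) :
    ∃ x ∈ T, x ∈ Subgroup.normalizer (Q : Set G) ∧ x ∉ Q := by
  have := hT.isNilpotent
  have hlt : Q.subgroupOf T < ⊤ := by
    rw [lt_top_iff_ne_top]
    intro h
    exact not_le_of_gt hQT (Subgroup.subgroupOf_eq_top.mp h)
  obtain ⟨x, hx, hxQ⟩ := SetLike.exists_of_lt
    (Group.normalizerCondition_of_isNilpotent (G := T) _ hlt)
  refine ⟨x, x.2, ?_, fun h => hxQ (Subgroup.mem_subgroupOf.mpr h)⟩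
  rw [Subgroup.mem_normalizer_iff] at hx ⊢
  intro h
  constructor
  · intro hh
    simpa [Subgroup.mem_subgroupOf] using (hx ⟨h, hQT.le hh⟩).mp hh
  · intro hh
    have : h ∈ T := by
      have h1 := mul_mem (mul_mem (inv_mem x.2) (hQT.le hh)) x.2
      simpa [mul_assoc] using h1
    exact (hx ⟨h, this⟩).mpr (by simpa [Subgroup.mem_subgroupOf] using hh)

end FixedPoints

theorem sum_eq_sum_fixed_of_perm {p : ℕ} [Fact p.Prime] {Γ α M : Type*} [Group Γ] [Finite Γ]
    (hΓ : IsPGroup p Γ) (ρ : Γ →* Equiv.Perm α) [AddCommMonoid M] (hM : ∀ m : M, p • m = 0)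
    (s : Finset α) (hs : ∀ (γ : Γ), ∀ a ∈ s, ρ γ a ∈ s) (F : α → M)
    (hF : ∀ (γ : Γ), ∀ a ∈ s, F (ρ γ a) = F a) [DecidablePred fun a => ∀ γ : Γ, ρ γ a = a] :
    ∑ a ∈ s, F a = ∑ a ∈ s with ∀ γ : Γ, ρ γ a = a, F a := by
  let := MulAction.compHom α ρ
  convert sum_eq_sum_fixed hΓ hM s hs F hF
  rfl

/-! ### The Brauer homomorphism -/

section BrauerMap

variable {k : Type*} [Field k] {G : Type*} [Group G]

theorem coeff_conjAlg (x : G) (a : MonoidAlgebra k G) (g : G) :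
    (conjAlg k x a).coeff g = a.coeff (x⁻¹ * g * x) := by
  have h : g = MulAut.conj x (x⁻¹ * g * x) := by simp [mul_assoc]
  conv_lhs => rw [h]
  exact Finsupp.mapDomain_apply (MulAut.conj x).injective _ _

theorem conjAlg_mul (x y : G) (a : MonoidAlgebra k G) :
    conjAlg k (x * y) a = conjAlg k x (conjAlg k y a) := by
  ext g
  simp only [coeff_conjAlg, mul_inv_rev, mul_assoc]

theorem conjAlg_one (a : MonoidAlgebra k G) : conjAlg k 1 a = a := by
  ext g
  simp [coeff_conjAlg]

variable (k) in
/-- The conjugation action of `G` on the set `kG`. -/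
def conjPerm : G →* Equiv.Perm (MonoidAlgebra k G) where
  toFun x :=
    { toFun := conjAlg k x
      invFun := conjAlg k x⁻¹
      left_inv := fun a => by rw [← conjAlg_mul, inv_mul_cancel, conjAlg_one]
      right_inv := fun a => by rw [← conjAlg_mul, mul_inv_cancel, conjAlg_one] }
  map_one' := by
    ext a : 1
    exact conjAlg_one a
  map_mul' x y := by
    ext a : 1
    exact conjAlg_mul x y a

theorem fixedAlg_anti {P Q : Subgroup G} (h : Q ≤ P) {a : MonoidAlgebra k G}
    (ha : a ∈ fixedAlg k P) : a ∈ fixedAlg k Q := fun x hx => ha x (h hx)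

theorem coeff_conj_of_mem_fixedAlg {P : Subgroup G} {a : MonoidAlgebra k G}
    (ha : a ∈ fixedAlg k P) {x : G} (hx : x ∈ P) (g : G) :
    a.coeff (x * g * x⁻¹) = a.coeff g := by
  have h := congrArg (fun b => b.coeff (x * g * x⁻¹)) (ha x hx)
  simp only [coeff_conjAlg] at h
  rw [← h]
  congr 1
  group

theorem coeff_brauerMap (P : Subgroup G) (a : MonoidAlgebra k G)
    (c : Subgroup.centralizer (P : Set G)) : (brauerMap P a).coeff c = a.coeff c := rfl

theorem brauerMap_add (P : Subgroup G) (a b : MonoidAlgebra k G) :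
    brauerMap P (a + b) = brauerMap P a + brauerMap P b := by
  ext c
  simp [coeff_brauerMap]

variable (k) in
/-- The Brauer map as an additive map. -/
def brauerAddHom (P : Subgroup G) : MonoidAlgebra k G →+ CentAlg k P where
  toFun := brauerMap P
  map_zero' := by
    ext c
    simp [coeff_brauerMap]
  map_add' := brauerMap_add P

theorem brauerMap_zero (P : Subgroup G) : brauerMap P (0 : MonoidAlgebra k G) = 0 :=
  (brauerAddHom k P).map_zero

theorem brauerMap_sum {ι : Type*} (P : Subgroup G) (s : Finset ι) (f : ι → MonoidAlgebra k G) :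
    brauerMap P (∑ i ∈ s, f i) = ∑ i ∈ s, brauerMap P (f i) :=
  map_sum (brauerAddHom k P) f s

theorem brauerMap_one (P : Subgroup G) : brauerMap P (1 : MonoidAlgebra k G) = 1 := by
  classical
  ext c
  rw [coeff_brauerMap, MonoidAlgebra.one_def, MonoidAlgebra.one_def, MonoidAlgebra.coeff_single,
    MonoidAlgebra.coeff_single, Finsupp.single_apply, Finsupp.single_apply]
  simp only [eq_comm (a := (1 : G)), eq_comm (a := (1 : Subgroup.centralizer (P : Set G))),
    OneMemClass.coe_eq_one]

variable (k) in
/-- The inclusion of `kC_G(P)` in `kG`. -/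
def centIncl (P : Subgroup G) : CentAlg k P →ₐ[k] MonoidAlgebra k G :=
  MonoidAlgebra.mapDomainAlgHom k k (Subgroup.centralizer (P : Set G)).subtype

theorem coeff_centIncl (P : Subgroup G) (a : CentAlg k P)
    (c : Subgroup.centralizer (P : Set G)) : (centIncl k P a).coeff c = a.coeff c :=
  Finsupp.mapDomain_apply Subtype.val_injective _ _

theorem coeff_centIncl_of_notMem (P : Subgroup G) (a : CentAlg k P) {g : G}
    (hg : g ∉ Subgroup.centralizer (P : Set G)) : (centIncl k P a).coeff g = 0 :=
  Finsupp.mapDomain_of_notMem_range _ _ (by simpa using hg)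

theorem brauerMap_centIncl (P : Subgroup G) (a : CentAlg k P) :
    brauerMap P (centIncl k P a) = a := by
  ext c
  rw [coeff_brauerMap, coeff_centIncl]

theorem centIncl_injective (P : Subgroup G) : Function.Injective (centIncl k P) :=
  Function.LeftInverse.injective (brauerMap_centIncl P)

theorem centralizer_anti {Q S : Subgroup G} (h : Q ≤ S) :
    Subgroup.centralizer (S : Set G) ≤ Subgroup.centralizer (Q : Set G) :=
  Subgroup.centralizer_le h

theorem centIncl_mem_fixedAlg (P : Subgroup G) (a : CentAlg k P) :
    centIncl k P a ∈ fixedAlg k P := by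
  intro x hx
  ext g
  rw [coeff_conjAlg]
  by_cases hg : g ∈ Subgroup.centralizer (P : Set G)
  · congr 1
    rw [mul_assoc, ← Subgroup.mem_centralizer_iff.mp hg x hx, inv_mul_cancel_left]
  · rw [coeff_centIncl_of_notMem P a hg, coeff_centIncl_of_notMem P a]
    intro h
    apply hg
    have h1 := Subgroup.mem_centralizer_iff.mp h x hx
    have h2 : x⁻¹ * g * x = g := by
      rw [← mul_assoc, ← mul_assoc, mul_inv_cancel, one_mul] at h1
      exact (mul_right_cancel h1).symm
    rwa [h2] at h

/-- Since `C_G(S) ≤ C_G(Q)`, truncating to `C_G(Q)` first loses nothing. In particular `Br_Q(a) = 0`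
forces `Br_S(a) = 0`. -/
theorem brauerMap_centIncl_brauerMap {Q S : Subgroup G} (h : Q ≤ S) (a : MonoidAlgebra k G) :
    brauerMap S (centIncl k Q (brauerMap Q a)) = brauerMap S a := by
  ext c
  rw [coeff_brauerMap, coeff_brauerMap]
  exact coeff_centIncl Q _ ⟨c, centralizer_anti h c.2⟩

theorem mem_centralizer_conj_iff {Q : Subgroup G} {x : G}
    (hx : x ∈ Subgroup.normalizer (Q : Set G)) {g : G} :
    x⁻¹ * g * x ∈ Subgroup.centralizer (Q : Set G) ↔ g ∈ Subgroup.centralizer (Q : Set G) := by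
  simp only [Subgroup.mem_centralizer_iff]
  constructor
  · intro h u hu
    have h1 := h _ ((Subgroup.mem_normalizer_iff''.mp hx u).mp hu)
    calc u * g = x * (x⁻¹ * u * x * (x⁻¹ * g * x)) * x⁻¹ := by group
      _ = g * u := by rw [h1]; group
  · intro h u hu
    have h1 := h _ ((Subgroup.mem_normalizer_iff.mp hx u).mp hu)
    calc u * (x⁻¹ * g * x) = x⁻¹ * (x * u * x⁻¹ * g) * x := by group
      _ = x⁻¹ * g * x * u := by rw [h1]; group

theorem conjAlg_centIncl_brauerMap {Q : Subgroup G} {x : G}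
    (hx : x ∈ Subgroup.normalizer (Q : Set G)) {a : MonoidAlgebra k G} (ha : conjAlg k x a = a) :
    conjAlg k x (centIncl k Q (brauerMap Q a)) = centIncl k Q (brauerMap Q a) := by
  ext g
  rw [coeff_conjAlg]
  by_cases hg : g ∈ Subgroup.centralizer (Q : Set G)
  · have h := coeff_centIncl Q (brauerMap Q a) ⟨_, (mem_centralizer_conj_iff hx).mpr hg⟩
    have h' := coeff_centIncl Q (brauerMap Q a) ⟨g, hg⟩
    rw [coeff_brauerMap] at h h'
    simp only at h h'
    rw [h, h', ← coeff_conjAlg, ha]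
  · rw [coeff_centIncl_of_notMem Q _ hg, coeff_centIncl_of_notMem Q]
    rwa [mem_centralizer_conj_iff hx]

variable [Finite G] {p : ℕ} [Fact p.Prime] [CharP k p]

/-- The Brauer map is multiplicative on `(kG)^P`. -/
theorem brauerMap_mul {P : Subgroup G} (hP : IsPGroup p P) {a b : MonoidAlgebra k G}
    (ha : a ∈ fixedAlg k P) (hb : b ∈ fixedAlg k P) :
    brauerMap P (a * b) = brauerMap P a * brauerMap P b := by
  classical
  have := Fintype.ofFinite G
  have hmul : ∀ {H : Type _} [Group H] [Fintype H] (a b : MonoidAlgebra k H) (g : H),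
      (a * b).coeff g = ∑ x, a.coeff x * b.coeff (x⁻¹ * g) := by
    intro H _ _ a b g
    rw [MonoidAlgebra.coeff_mul_apply_left]
    exact Finsupp.sum_fintype _ _ fun i => by rw [zero_mul]
  ext c
  rw [coeff_brauerMap, hmul, MonoidAlgebra.coeff_mul_apply_left, Finsupp.sum_fintype _ _
    fun i => by rw [zero_mul]]
  simp only [coeff_brauerMap]
  have hc := Subgroup.mem_centralizer_iff.mp c.2
  -- `P` acts on the summation index by conjugation and leaves the summand invariant because `c`
  -- centralizes `P`; the fixed points are exactly `C_G(P)`.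
  rw [sum_eq_sum_fixed_of_perm hP
    ((MulAut.toPerm G).comp ((MulAut.conj (G := G)).comp P.subtype))
    (fun m : k => by rw [nsmul_eq_mul, CharP.cast_eq_zero, zero_mul]) Finset.univ
    (fun _ _ _ => Finset.mem_univ _)]
  · refine Finset.sum_bij' (fun x hx => ⟨x, ?_⟩) (fun x _ => x) (fun _ _ => Finset.mem_univ _)
      ?_ (fun _ _ => rfl) (fun _ _ => rfl) (fun _ _ => rfl)
    · rw [Finset.mem_filter] at hx
      rw [Subgroup.mem_centralizer_iff]
      intro u hu
      have h : u * x * u⁻¹ = x := hx.2 ⟨u, hu⟩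
      exact mul_inv_eq_iff_eq_mul.mp h
    · intro x _
      rw [Finset.mem_filter]
      refine ⟨Finset.mem_univ _, fun u => ?_⟩
      change (u : G) * x * (u : G)⁻¹ = x
      rw [mul_inv_eq_iff_eq_mul]
      exact Subgroup.mem_centralizer_iff.mp x.2 u u.2
  · intro u x _
    change a.coeff ((u : G) * x * (u : G)⁻¹) * b.coeff (((u : G) * x * (u : G)⁻¹)⁻¹ * c) = _
    have h : ((u : G) * x * (u : G)⁻¹)⁻¹ * c = u * (x⁻¹ * c) * (u : G)⁻¹ := by
      have h1 : (u : G)⁻¹ * c = c * (u : G)⁻¹ := by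
        rw [inv_mul_eq_iff_eq_mul, ← mul_assoc, hc u u.2, mul_inv_cancel_right]
      rw [mul_inv_rev, mul_inv_rev, inv_inv, mul_assoc, mul_assoc, h1]
      simp only [mul_assoc]
    rw [h, coeff_conj_of_mem_fixedAlg ha u.2, coeff_conj_of_mem_fixedAlg hb u.2]

variable (k) in
/-- The Brauer homomorphism `(kG)^P → kC_G(P)`. -/
def brauerHom {P : Subgroup G} (hP : IsPGroup p P) : fixedAlg k P →+* CentAlg k P where
  toFun a := brauerMap P a.1
  map_zero' := brauerMap_zero P
  map_one' := brauerMap_one P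
  map_add' a b := brauerMap_add P a.1 b.1
  map_mul' a b := brauerMap_mul hP a.2 b.2

end BrauerMap

/-! ### Conjugation of pairs -/

section PairConj

variable {k : Type*} [Field k] {G : Type*} [Group G]

/-- The type of `elem` depends on `subgroup`; comparing the elements inside `kG` avoids casts. -/
theorem Pair.ext_centIncl {X Y : Pair k G} (h : X.subgroup = Y.subgroup)
    (h' : centIncl k X.subgroup X.elem = centIncl k Y.subgroup Y.elem) : X = Y := by
  obtain ⟨P, e⟩ := X
  obtain ⟨Q, f⟩ := Y
  obtain rfl : P = Q := h
  obtain rfl : e = f := centIncl_injective P h'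
  rfl

/-- Conjugation as an isomorphism of centralizers. -/
def conjCentralizerEquiv (x : G) (P : Subgroup G) :
    Subgroup.centralizer (P : Set G) ≃*
      Subgroup.centralizer ((P.map (MulAut.conj x).toMonoidHom : Subgroup G) : Set G) :=
  MulEquiv.ofBijective (conjCentralizer x P) (by
    constructor
    · intro a b h
      apply Subtype.ext
      have h' : x * (a : G) * x⁻¹ = x * (b : G) * x⁻¹ := congrArg Subtype.val h
      exact mul_left_cancel (mul_right_cancel h')
    · rintro ⟨g, hg⟩
      refine ⟨⟨x⁻¹ * g * x, ?_⟩, ?_⟩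
      · rw [Subgroup.mem_centralizer_iff] at hg ⊢
        intro u hu
        have h := hg (x * u * x⁻¹) ⟨u, hu, rfl⟩
        calc u * (x⁻¹ * g * x) = x⁻¹ * (x * u * x⁻¹ * g) * x := by group
          _ = x⁻¹ * g * x * u := by rw [h]; group
      · apply Subtype.ext
        change x * (x⁻¹ * g * x) * x⁻¹ = g
        group)

theorem centIncl_conj_elem (x : G) (X : Pair k G) :
    centIncl k (X.conj x).subgroup (X.conj x).elem = conjAlg k x (centIncl k X.subgroup X.elem) := by
  ext g
  have h : g = x * (x⁻¹ * g * x) * x⁻¹ := by group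
  rw [coeff_conjAlg]
  by_cases hg : x⁻¹ * g * x ∈ Subgroup.centralizer (X.subgroup : Set G)
  · have h1 : g = (conjCentralizerEquiv x X.subgroup ⟨_, hg⟩ : G) := h
    refine Eq.trans (congrArg _ h1) ((coeff_centIncl _ _ _).trans ?_)
    refine Eq.trans ?_ (coeff_centIncl X.subgroup X.elem ⟨_, hg⟩).symm
    exact Finsupp.mapDomain_apply (conjCentralizerEquiv x X.subgroup).injective _ _
  · rw [coeff_centIncl_of_notMem _ _ hg, coeff_centIncl_of_notMem]
    intro hg'
    obtain ⟨c, hc⟩ := (conjCentralizerEquiv x X.subgroup).surjective ⟨g, hg'⟩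
    apply hg
    have hc' : x * (c : G) * x⁻¹ = g := congrArg Subtype.val hc
    rw [← hc']
    have : x⁻¹ * (x * (c : G) * x⁻¹) * x = c := by group
    rw [this]
    exact c.2

theorem Pair.conj_one (X : Pair k G) : X.conj 1 = X := by
  refine Pair.ext_centIncl ?_ ?_
  · ext g
    simp [Pair.conj]
  · rw [centIncl_conj_elem, conjAlg_one]

theorem Pair.conj_mul (x y : G) (X : Pair k G) : X.conj (x * y) = (X.conj y).conj x := by
  refine Pair.ext_centIncl ?_ ?_
  · simp only [Pair.conj, Subgroup.map_map, map_mul]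
    rfl
  · rw [centIncl_conj_elem, centIncl_conj_elem, centIncl_conj_elem, conjAlg_mul]

theorem Pair.conj_inv_conj (x : G) (X : Pair k G) : (X.conj x).conj x⁻¹ = X := by
  rw [← Pair.conj_mul, inv_mul_cancel, Pair.conj_one]

theorem brauerMap_conjAlg (x : G) (P : Subgroup G) (a : MonoidAlgebra k G) :
    brauerMap (P.map (MulAut.conj x).toMonoidHom) (conjAlg k x a) =
      MonoidAlgebra.mapDomainRingEquiv k (conjCentralizerEquiv x P) (brauerMap P a) := by
  ext c
  obtain ⟨c, rfl⟩ := (conjCentralizerEquiv x P).surjective c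
  rw [coeff_brauerMap, coeff_conjAlg, MonoidAlgebra.coeff_mapDomainRingEquiv]
  change _ = (brauerMap P a).coeff ((conjCentralizerEquiv x P).symm (conjCentralizerEquiv x P c))
  rw [MulEquiv.symm_apply_apply, coeff_brauerMap]
  congr 1
  change x⁻¹ * (x * (c : G) * x⁻¹) * x = c
  group

theorem Pair.conj_mk (x : G) (P : Subgroup G) (e : CentAlg k P) : Pair.conj x ⟨P, e⟩ =
    ⟨P.map (MulAut.conj x).toMonoidHom,
      MonoidAlgebra.mapDomainRingEquiv k (conjCentralizerEquiv x P) e⟩ := by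
  unfold Pair.conj
  congr 1

theorem Pair.isBlockIdempotent_conj {X : Pair k G} (hX : IsBlockIdempotent X.elem) (x : G) :
    IsBlockIdempotent (X.conj x).elem := by
  obtain ⟨P, e⟩ := X
  rw [Pair.conj_mk]
  exact hX.map_equiv _

theorem Pair.associated_conj {X : Pair k G} (x : G) {i : MonoidAlgebra k G}
    (h : X.Associated i) : (X.conj x).Associated (conjAlg k x i) := by
  obtain ⟨P, e⟩ := X
  unfold Pair.Associated at h ⊢
  rw [Pair.conj_mk]
  dsimp only at h ⊢
  rw [brauerMap_conjAlg, ← map_mul, h.1]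
  exact ⟨rfl, fun h0 => h.2 ((map_eq_zero_iff _ (RingEquiv.injective _)).mp h0)⟩

theorem conjAlg_mem_fixedAlg (x : G) {P : Subgroup G} {a : MonoidAlgebra k G}
    (ha : a ∈ fixedAlg k P) : conjAlg k x a ∈ fixedAlg k (P.map (MulAut.conj x).toMonoidHom) := by
  rintro _ ⟨u, hu, rfl⟩
  change conjAlg k (x * u * x⁻¹) (conjAlg k x a) = conjAlg k x a
  rw [← conjAlg_mul, inv_mul_cancel_right, conjAlg_mul, ha u hu]

/-- Conjugation as an isomorphism of fixed point algebras. -/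
def conjFixed (x : G) (P : Subgroup G) :
    fixedAlg k P ≃+* fixedAlg k (P.map (MulAut.conj x).toMonoidHom) :=
  RingEquiv.ofBijective
    (((conjAlg k x : MonoidAlgebra k G →+* MonoidAlgebra k G).comp
      (fixedAlg k P).val.toRingHom).codRestrict
        (fixedAlg k (P.map (MulAut.conj x).toMonoidHom)).toSubring
        fun a => conjAlg_mem_fixedAlg x a.2) (by
    constructor
    · intro a b h
      exact Subtype.ext ((conjPerm k x).injective (congrArg Subtype.val h))
    · rintro ⟨a, ha⟩
      refine ⟨⟨conjAlg k x⁻¹ a, fun u hu => ?_⟩, Subtype.ext ?_⟩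
      · rw [← conjAlg_mul]
        have h : u * x⁻¹ = x⁻¹ * (x * u * x⁻¹) := by group
        rw [h, conjAlg_mul]
        exact congrArg _ (ha _ ⟨u, hu, rfl⟩)
      · change conjAlg k x (conjAlg k x⁻¹ a) = a
        rw [← conjAlg_mul, mul_inv_cancel, conjAlg_one])

theorem IsPrimitiveIdempotent.map_equiv {A B : Type*} [Ring A] [Ring B] (φ : A ≃+* B) {i : A}
    (h : IsPrimitiveIdempotent i) : IsPrimitiveIdempotent (φ i) := by
  refine ⟨h.1.map φ, by simpa using h.2.1, fun f g hf hg hfg hgf hsum => ?_⟩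
  refine (h.2.2 (φ.symm f) (φ.symm g) (hf.map φ.symm) (hg.map φ.symm) ?_ ?_ ?_).imp ?_ ?_
  · rw [← map_mul, hfg, map_zero]
  · rw [← map_mul, hgf, map_zero]
  · rw [← map_add, hsum, φ.symm_apply_apply]
  · simp
  · simp

theorem Pair.conj_le_conj {X Y : Pair k G} (h : Y ≤ X) (x : G) : Y.conj x ≤ X.conj x := by
  refine ⟨Subgroup.map_mono h.1, fun i hi hXi => ?_⟩
  have h1 : X.Associated (conjAlg k x⁻¹ i) := by
    have := Pair.associated_conj x⁻¹ hXi
    rwa [Pair.conj_inv_conj] at this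
  have h2 := h.2 ((conjFixed x X.subgroup).symm i) (hi.map_equiv _)
  have h3 : (((conjFixed x X.subgroup).symm i : fixedAlg k X.subgroup) : MonoidAlgebra k G) =
      conjAlg k x⁻¹ i := by
    apply (conjPerm k x).injective
    have h4 := congrArg Subtype.val ((conjFixed x X.subgroup).apply_symm_apply i)
    refine Eq.trans h4 ?_
    change (i : MonoidAlgebra k G) = conjAlg k x (conjAlg k x⁻¹ i)
    rw [← conjAlg_mul, mul_inv_cancel, conjAlg_one]
  rw [h3] at h2
  have h5 := Pair.associated_conj x (h2 h1)
  rwa [← conjAlg_mul, mul_inv_cancel, conjAlg_one] at h5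

end PairConj

/-! ### Existence and uniqueness of smaller Brauer pairs -/

section BrauerPairs

variable {k : Type*} [Field k] {G : Type*} [Group G] [Finite G] {p : ℕ} [Fact p.Prime] [CharP k p]

include p in
-- Inside `kG`, the algebra `kC_G(S)` is contained in `kC_G(Q)`, so `f` commutes with it; `Br_S`
-- preserves the relation.
theorem brauerMap_comm_of_forall_comm {Q S : Subgroup G} (hS : IsPGroup p S) (hQS : Q ≤ S)
    {f : CentAlg k Q} (hf : ∀ c, f * c = c * f) (hfS : centIncl k Q f ∈ fixedAlg k S)
    (c : CentAlg k S) : brauerMap S (centIncl k Q f) * c = c * brauerMap S (centIncl k Q f) := by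
  have hc := centIncl_mem_fixedAlg S c
  have h : centIncl k S c = centIncl k Q (brauerMap Q (centIncl k S c)) := by
    ext g
    by_cases hg : g ∈ Subgroup.centralizer (Q : Set G)
    · exact (coeff_centIncl Q (brauerMap Q (centIncl k S c)) ⟨g, hg⟩).symm
    · rw [coeff_centIncl_of_notMem Q _ hg, coeff_centIncl_of_notMem S]
      exact fun h => hg (centralizer_anti hQS h)
  have hcomm : centIncl k Q f * centIncl k S c = centIncl k S c * centIncl k Q f := by
    rw [h, ← map_mul, hf, map_mul]
  have := congrArg (brauerMap S) hcomm
  rwa [brauerMap_mul hS hfS hc, brauerMap_mul hS hc hfS, brauerMap_centIncl] at this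

include p in
theorem isIdempotentElem_brauerMap {S : Subgroup G} (hS : IsPGroup p S) {a : MonoidAlgebra k G}
    (ha : a ∈ fixedAlg k S) (h : IsIdempotentElem a) : IsIdempotentElem (brauerMap S a) := by
  change _ = _
  rw [← brauerMap_mul hS ha ha, h]

include p in
/-- If `Br_P(a)` is not annihilated by the block idempotent `e`, there is a primitive idempotent
below `a` associated to `(P, e)`. -/
theorem exists_primitive_associated {P : Subgroup G} (hP : IsPGroup p P) {e : CentAlg k P}
    (he : IsBlockIdempotent e) {a : fixedAlg k P} (ha : IsIdempotentElem a)
    (h : e * brauerMap P (a : MonoidAlgebra k G) ≠ 0) :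
    ∃ j : fixedAlg k P, IsPrimitiveIdempotent j ∧ a * j = j ∧ j * a = j ∧
      (⟨P, e⟩ : Pair k G).Associated (j : MonoidAlgebra k G) := by
  have : IsArtinianRing (fixedAlg k P) := IsArtinianRing.of_finite k _
  obtain ⟨j, hj, h1, h2, h3⟩ := exists_primitive_le_of_map_ne_zero
    ((AddMonoidHom.mulLeft e).comp (brauerHom k hP).toAddMonoidHom) ha h
  refine ⟨j, hj, h1, h2, ?_⟩
  have h3' : e * brauerMap P (j : MonoidAlgebra k G) ≠ 0 := h3
  -- The inclusion `kC_G(P) ⊆ (kG)^P` lifts `e`, so the dichotomy for images of primitive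
  -- idempotents upgrades `e Br_P(j) ≠ 0` to `e Br_P(j) = Br_P(j)`.
  have hφ : brauerHom k hP ⟨centIncl k P e, centIncl_mem_fixedAlg P e⟩ = e :=
    brauerMap_centIncl P e
  have h4 := hj.map_mul_eq_zero_or_eq k (brauerHom k hP)
    (a := ⟨centIncl k P e, centIncl_mem_fixedAlg P e⟩)
    (by rw [hφ]; exact he.isIdempotentElem) (by rw [hφ]; exact he.comm _)
  rw [hφ] at h4
  exact ⟨h4.resolve_left h3', fun h0 => h3' (by rw [h0, mul_zero])⟩

include p in
theorem exists_associated {P : Subgroup G} (hP : IsPGroup p P) {e : CentAlg k P}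
    (he : IsBlockIdempotent e) : ∃ j : fixedAlg k P, IsPrimitiveIdempotent j ∧
      (⟨P, e⟩ : Pair k G).Associated (j : MonoidAlgebra k G) := by
  obtain ⟨j, hj, -, -, h⟩ := exists_primitive_associated hP he (a := 1) IsIdempotentElem.one
    (by
      have h1 : brauerMap P ((1 : fixedAlg k P) : MonoidAlgebra k G) = 1 := brauerMap_one P
      rw [h1, mul_one]
      exact he.ne_zero)
  exact ⟨j, hj, h⟩

omit [Finite G] in
theorem exists_block_centIncl_eq_conj {Q : Subgroup G} {x : G}
    (hx : x ∈ Subgroup.normalizer (Q : Set G)) {f : CentAlg k Q} (hf : IsBlockIdempotent f) :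
    ∃ f' : CentAlg k Q, IsBlockIdempotent f' ∧
      centIncl k Q f' = conjAlg k x (centIncl k Q f) := by
  have h1 : (Pair.conj x ⟨Q, f⟩ : Pair k G).subgroup = Q :=
    Subgroup.mem_normalizer_iff_map_conj_eq.mp hx
  have h2 := centIncl_conj_elem x (⟨Q, f⟩ : Pair k G)
  have h3 := Pair.isBlockIdempotent_conj (X := (⟨Q, f⟩ : Pair k G)) hf x
  generalize Pair.conj x ⟨Q, f⟩ = Y at h1 h2 h3
  obtain ⟨Q', f'⟩ := Y
  subst h1
  exact ⟨f', h3, h2⟩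

include p in
/-- A block idempotent `g` of `kC_G(R)`, where `Q` is normal in the `p`-group `R`, lies below
`Br_R(f)` for an `R`-stable block idempotent `f` of `kC_G(Q)`. -/
theorem exists_stable_block {Q R : Subgroup G} (hR : IsPGroup p R)
    (hRQ : R ≤ Subgroup.normalizer (Q : Set G)) (hQR : Q ≤ R) {g : CentAlg k R}
    (hg : IsBlockIdempotent g) :
    ∃ f : CentAlg k Q, IsBlockIdempotent f ∧ centIncl k Q f ∈ fixedAlg k R ∧
      brauerMap R (centIncl k Q f) * g = g := by
  classical
  set s := ((finite_setOf_isBlockIdempotent (A := CentAlg k Q) k).toFinset).image (centIncl k Q)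
  have hs : ∀ b ∈ s, ∃ f, IsBlockIdempotent f ∧ centIncl k Q f = b := by
    intro b hb
    obtain ⟨f, hf, rfl⟩ := Finset.mem_image.mp hb
    exact ⟨f, by simpa using hf, rfl⟩
  have hs' : ∀ f : CentAlg k Q, IsBlockIdempotent f → centIncl k Q f ∈ s := by
    intro f hf
    exact Finset.mem_image_of_mem _ (by simpa using hf)
  have hsum : ∑ b ∈ s, brauerMap R b = 1 := by
    rw [← brauerMap_sum, Finset.sum_image fun a _ b _ h => centIncl_injective Q h, ← map_sum,
      sum_blocks_eq_one k, map_one, brauerMap_one]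
  -- `R` permutes the blocks of `kC_G(Q)` and `Br_R` is constant on orbits, so modulo `p` only the
  -- `R`-stable blocks contribute to `1`.
  rw [sum_eq_sum_fixed_of_perm hR ((conjPerm k).comp R.subtype) (fun m => by
    rw [← Nat.cast_smul_eq_nsmul k, CharP.cast_eq_zero, zero_smul]) s] at hsum
  · have hne : ∃ b ∈ s.filter (fun b => ∀ γ : R, ((conjPerm k).comp R.subtype) γ b = b),
        brauerMap R b * g ≠ 0 := by
      by_contra! h
      apply hg.ne_zero
      rw [← one_mul g, ← hsum, Finset.sum_mul]
      exact Finset.sum_eq_zero h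
    obtain ⟨b, hb, hbg⟩ := hne
    obtain ⟨hbs, hfix⟩ := Finset.mem_filter.mp hb
    obtain ⟨f, hf, rfl⟩ := hs b hbs
    have hfR : centIncl k Q f ∈ fixedAlg k R := fun x hx => hfix ⟨x, hx⟩
    refine ⟨f, hf, hfR, ?_⟩
    exact (hg.mul_eq_zero_or_eq (brauerMap_comm_of_forall_comm hR hQR hf.comm hfR)
      (isIdempotentElem_brauerMap hR hfR (hf.isIdempotentElem.map _))).resolve_left hbg
  · intro x b hb
    obtain ⟨f, hf, rfl⟩ := hs b hb
    obtain ⟨f', hf', h⟩ := exists_block_centIncl_eq_conj (hRQ x.2) hf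
    change conjAlg k (x : G) (centIncl k Q f) ∈ s
    rw [← h]
    exact hs' f' hf'
  · intro x b _
    ext c
    change (conjAlg k (x : G) b).coeff c = b.coeff c
    rw [coeff_conjAlg, mul_assoc, ← Subgroup.mem_centralizer_iff.mp c.2 x x.2,
      inv_mul_cancel_left]

omit [CharP k p] in
/-- An element `w` of `kC_G(Q)` which is stable under `N_P(Q)` and supported on elements with
centralizer `Q` in `N_P(Q)` is the image under `Br_Q` of an element of `(kG)^P` in the kernel
of `Br_P`. -/
theorem exists_fixed_lift {P Q : Subgroup G} (hP : IsPGroup p P) (hQP : Q < P)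
    (w : CentAlg k Q)
    (hw : ∀ x ∈ P, x ∈ Subgroup.normalizer (Q : Set G) →
      conjAlg k x (centIncl k Q w) = centIncl k Q w)
    (hw' : ∀ g, (centIncl k Q w).coeff g ≠ 0 → ∀ x ∈ P, x ∈ Subgroup.normalizer (Q : Set G) →
      x * g = g * x → x ∈ Q) :
    ∃ a ∈ fixedAlg k P, brauerMap Q a = w ∧ brauerMap P a = 0 := by
  classical
  set v : G → k := fun g => (centIncl k Q w).coeff g with hv
  have hcent : ∀ g, v g ≠ 0 → g ∈ Subgroup.centralizer (Q : Set G) := fun g hg =>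
    by_contra fun h => hg (coeff_centIncl_of_notMem Q w h)
  -- If `C_P(g)` were larger than `Q`, it would contain an element normalizing `Q` outside `Q`,
  -- contrary to the support condition.
  have hstab : ∀ g, v g ≠ 0 → ∀ x ∈ P, x * g = g * x → x ∈ Q := by
    intro g hg
    by_contra! h
    obtain ⟨x, hxP, hxg, hxQ⟩ := h
    have hlt : Q < P ⊓ Subgroup.centralizer {g} := by
      refine lt_of_le_of_ne (le_inf hQP.le fun u hu => ?_) fun h => hxQ ?_
      · rw [Subgroup.mem_centralizer_singleton_iff]
        exact Subgroup.mem_centralizer_iff.mp (hcent g hg) u hu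
      · rw [h]
        exact ⟨hxP, Subgroup.mem_centralizer_singleton_iff.mpr hxg⟩
    obtain ⟨y, hy, hyN, hyQ⟩ := exists_mem_normalizer_notMem (hP.to_le inf_le_left) hlt
    exact hyQ (hw' g hg y hy.1 hyN (Subgroup.mem_centralizer_singleton_iff.mp hy.2))
  -- Here `xQx⁻¹` centralizes `xgx⁻¹`, hence lies in `Q` by `hstab`; so `x` normalizes `Q` and
  -- stability of `w` applies.
  have hnorm : ∀ g ∈ Subgroup.centralizer (Q : Set G), ∀ x ∈ P, v (x * g * x⁻¹) ≠ 0 →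
      v (x * g * x⁻¹) = v g := by
    intro g hg x hx hne
    have hxN : x ∈ Subgroup.normalizer (Q : Set G) := by
      refine Subgroup.mem_normalizer_fintype fun u hu => ?_
      refine hstab _ hne _ (mul_mem (mul_mem hx (hQP.le hu)) (inv_mem hx)) ?_
      have h := Subgroup.mem_centralizer_iff.mp hg u hu
      calc x * u * x⁻¹ * (x * g * x⁻¹) = x * (u * g) * x⁻¹ := by group
        _ = x * g * x⁻¹ * (x * u * x⁻¹) := by rw [h]; group
    have h := congrArg (fun b => b.coeff (x * g * x⁻¹)) (hw x hx hxN)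
    simp only [coeff_conjAlg] at h
    rw [hv]
    dsimp only
    rw [← h]
    congr 1
    group
  -- The lift extends `v` to a function constant on `P`-classes and zero off the classes meeting its
  -- support; `hnorm` makes the chosen conjugate irrelevant.
  set F : G → k := fun g => if h : ∃ x ∈ P, v (x * g * x⁻¹) ≠ 0 then
    v (h.choose * g * h.choose⁻¹) else 0 with hF
  have hFeq : ∀ g, ∀ x ∈ P, v (x * g * x⁻¹) ≠ 0 → F g = v (x * g * x⁻¹) := by
    intro g x hx hne
    have h : ∃ x ∈ P, v (x * g * x⁻¹) ≠ 0 := ⟨x, hx, hne⟩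
    rw [hF]
    dsimp only
    rw [dif_pos h]
    obtain ⟨hyP, hyne⟩ := h.choose_spec
    set y := h.choose
    have h1 : y * g * y⁻¹ = (y * x⁻¹) * (x * g * x⁻¹) * (y * x⁻¹)⁻¹ := by group
    rw [h1] at hyne ⊢
    exact hnorm _ (hcent _ hne) _ (mul_mem hyP (inv_mem hx)) hyne
  have hFzero : ∀ g, (∀ x ∈ P, v (x * g * x⁻¹) = 0) → F g = 0 := by
    intro g h
    rw [hF]
    exact dif_neg (by simpa using h)
  have hFinv : ∀ g, ∀ y ∈ P, F (y⁻¹ * g * y) = F g := by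
    intro g y hy
    by_cases h : ∃ x ∈ P, v (x * g * x⁻¹) ≠ 0
    · obtain ⟨x, hx, hne⟩ := h
      have h1 : x * g * x⁻¹ = (x * y) * (y⁻¹ * g * y) * (x * y)⁻¹ := by group
      rw [hFeq g x hx hne, h1]
      rw [h1] at hne
      exact hFeq _ _ (mul_mem hx hy) hne
    · push Not at h
      rw [hFzero g h, hFzero]
      intro x hx
      have h1 : x * (y⁻¹ * g * y) * x⁻¹ = (x * y⁻¹) * g * (x * y⁻¹)⁻¹ := by group
      rw [h1]
      exact h _ (mul_mem hx (inv_mem hy))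
  have hconj_one : ∀ g : G, 1 * g * 1⁻¹ = g := fun g => by group
  refine ⟨MonoidAlgebra.ofCoeff (Finsupp.equivFunOnFinite.symm F), ?_, ?_, ?_⟩
  · intro y hy
    ext g
    rw [coeff_conjAlg]
    exact hFinv g y hy
  · ext c
    rw [coeff_brauerMap, ← coeff_centIncl Q w c]
    change F c = v c
    by_cases h : ∃ x ∈ P, v (x * c * x⁻¹) ≠ 0
    · obtain ⟨x, hx, hne⟩ := h
      rw [hFeq c x hx hne, hnorm c c.2 x hx hne]
    · push Not at h
      rw [hFzero c h, ← hconj_one c, h 1 (one_mem P)]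
  · ext c
    rw [coeff_brauerMap]
    change F c = 0
    refine hFzero c fun x hx => by_contra fun hne => ?_
    have hc := Subgroup.mem_centralizer_iff.mp c.2
    rw [hc x hx, mul_inv_cancel_right] at hne
    -- An element of `C_G(P)` in the support of `v` would force `P ≤ Q`.
    exact not_le_of_gt hQP fun u hu => hstab c hne u hu (hc u hu)

include p in
/-- Below a Brauer pair `(P, e)` there is a Brauer pair `(Q, f)` for every `Q ≤ P`. -/
theorem exists_block_le {P : Subgroup G} (hP : IsPGroup p P) {e : CentAlg k P}
    (he : IsBlockIdempotent e) (Q : Subgroup G) (hQP : Q ≤ P) :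
    ∃ f : CentAlg k Q, IsBlockIdempotent f ∧ (⟨Q, f⟩ : Pair k G) ≤ ⟨P, e⟩ := by
  induction Q using WellFoundedGT.induction with
  | _ Q ih =>
  rcases hQP.eq_or_lt with rfl | hlt
  · exact ⟨e, he, le_rfl, fun i _ h => h⟩
  set R := P ⊓ Subgroup.normalizer (Q : Set G) with hRdef
  have hQR' : Q ≤ R := le_inf hQP Subgroup.le_normalizer
  have hQR : Q < R := by
    obtain ⟨x, hxP, hxN, hxQ⟩ := exists_mem_normalizer_notMem hP hlt
    exact SetLike.lt_iff_le_and_exists.mpr ⟨hQR', x, Subgroup.mem_inf.mpr ⟨hxP, hxN⟩, hxQ⟩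
  obtain ⟨g, hg, hgP⟩ := ih R hQR inf_le_left
  obtain ⟨f, hf, hfR, hfg⟩ := exists_stable_block (hP.to_le inf_le_left) inf_le_right hQR' hg
  -- The block `f` was chosen from `g` alone, so one `f` serves every primitive idempotent `i`.
  refine ⟨f, hf, hQP, fun i hi hassoc => ?_⟩
  have hiP := i.2
  have hne : ∀ S ≤ P, brauerMap S (i : MonoidAlgebra k G) ≠ 0 := by
    intro S hS h0
    apply hassoc.2
    change brauerMap P (i : MonoidAlgebra k G) = 0
    rw [← brauerMap_centIncl_brauerMap hS, h0, map_zero, brauerMap_zero]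
  refine ⟨?_, hne Q hQP⟩
  change f * brauerMap Q (i : MonoidAlgebra k G) = brauerMap Q (i : MonoidAlgebra k G)
  set β := brauerMap Q (i : MonoidAlgebra k G) with hβ
  have hii : (i : MonoidAlgebra k G) * i = i := congrArg Subtype.val hi.1
  have hQp := hP.to_le hQP
  have hiQ := fixedAlg_anti hQP hiP
  have hββ : β * β = β := by rw [hβ, ← brauerMap_mul hQp hiQ hiQ, hii]
  have hff : f * f = f := hf.isIdempotentElem
  -- `w` is the part of `Br_Q(i)` outside `f`; the goal is `w = 0`.
  set w := (1 - f) * β with hwdef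
  have hwβ : w * β = w := by rw [hwdef, mul_assoc, hββ]
  have hβw : β * w = w := by
    rw [hwdef, sub_mul, one_mul, mul_sub, ← mul_assoc, ← hf.comm, mul_assoc, hββ]
  have hww : w * w = w := by
    have h1 : (1 - f) * (1 - f) = 1 - f := hf.isIdempotentElem.one_sub
    calc w * w = (1 - f) * (β * w) := mul_assoc (1 - f) β w
      _ = w := by rw [hβw, hwdef, ← mul_assoc, h1]
  have hιw : centIncl k Q w = (1 - centIncl k Q f) * centIncl k Q β := by
    rw [hwdef, map_mul, map_sub, map_one]
  -- The block `eS` fixes `Br_S(i)`, so it suffices that `Br_S(f)` fixes `eS`. Otherwise `Br_S(f)`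
  -- kills `Br_S(i)`, hence `Br_R(f)` kills `Br_R(i)`, although it fixes `g` and `g` fixes `Br_R(i)
  -- ≠ 0`.
  have hvanish : ∀ S, Q < S → S ≤ R → brauerMap S (centIncl k Q w) = 0 := by
    intro S hQS hSR
    have hSP : S ≤ P := hSR.trans inf_le_left
    have hSp := hP.to_le hSP
    obtain ⟨eS, heS, hle⟩ := ih S hQS hSP
    have hassS := hle.2 i hi hassoc
    have hfS := fixedAlg_anti hSR hfR
    have hβS : centIncl k Q β ∈ fixedAlg k S := fun x hx =>
      conjAlg_centIncl_brauerMap (hSR hx).2 (hiP x (hSP hx))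
    have hmul : ∀ T, Q ≤ T → T ≤ R → brauerMap T (centIncl k Q f * centIncl k Q β) =
        brauerMap T (centIncl k Q f) * brauerMap T (i : MonoidAlgebra k G) := by
      intro T hQT hTR
      rw [brauerMap_mul (hP.to_le (hTR.trans inf_le_left)) (fixedAlg_anti hTR hfR) fun x hx =>
        conjAlg_centIncl_brauerMap (hTR hx).2 (hiP x (hTR hx).1),
        brauerMap_centIncl_brauerMap hQT]
    have h1 : brauerMap S (centIncl k Q f) * eS = eS := by
      refine (heS.mul_eq_zero_or_eq
        (brauerMap_comm_of_forall_comm hSp hQS.le hf.comm hfS)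
        (isIdempotentElem_brauerMap hSp hfS (hf.isIdempotentElem.map _))).resolve_left ?_
      intro h0
      have h2 : brauerMap S (centIncl k Q f * centIncl k Q β) = 0 := by
        rw [hmul S hQS.le hSR, ← hassS.1, ← mul_assoc]
        change brauerMap S (centIncl k Q f) * eS * _ = 0
        rw [h0, zero_mul]
      have h3 : brauerMap R (centIncl k Q f * centIncl k Q β) = 0 := by
        rw [← brauerMap_centIncl_brauerMap hSR, h2, map_zero, brauerMap_zero]
      rw [hmul R hQR' le_rfl] at h3
      have hassR := (hgP.2 i hi hassoc).1
      change g * brauerMap R (i : MonoidAlgebra k G) = brauerMap R (i : MonoidAlgebra k G) at hassR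
      rw [← hassR, ← mul_assoc, hfg, hassR] at h3
      exact hne R inf_le_left h3
    have h4 : eS * brauerMap S (i : MonoidAlgebra k G) = brauerMap S (i : MonoidAlgebra k G) :=
      hassS.1
    rw [hιw, sub_mul, one_mul, sub_eq_add_neg, brauerMap_add, ← neg_one_mul]
    have h5 : brauerMap S (-1 * (centIncl k Q f * centIncl k Q β)) =
        - brauerMap S (centIncl k Q f * centIncl k Q β) := by
      rw [neg_one_mul]
      exact (brauerAddHom k S).map_neg _
    rw [h5, hmul S hQS.le hSR, brauerMap_centIncl_brauerMap hQS.le]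
    nth_rewrite 2 [← h4]
    rw [← mul_assoc, h1, h4, add_neg_cancel]
  have hfix : ∀ x ∈ P, x ∈ Subgroup.normalizer (Q : Set G) →
      conjAlg k x (centIncl k Q w) = centIncl k Q w := by
    intro x hxP hxN
    rw [hιw, map_mul, map_sub, map_one, hfR x (Subgroup.mem_inf.mpr ⟨hxP, hxN⟩),
      conjAlg_centIncl_brauerMap hxN (hiP x hxP)]
  -- Apply `hvanish` to `S = Q⟨x⟩`: a support element commuting with `x` would lie in `C_G(S)`.
  have hsupp : ∀ g, (centIncl k Q w).coeff g ≠ 0 → ∀ x ∈ P,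
      x ∈ Subgroup.normalizer (Q : Set G) → x * g = g * x → x ∈ Q := by
    intro y hy x hxP hxN hxy
    by_contra hxQ
    have hyQ : y ∈ Subgroup.centralizer (Q : Set G) :=
      by_contra fun h => hy (coeff_centIncl_of_notMem Q w h)
    have hS : y ∈ Subgroup.centralizer ((Q ⊔ Subgroup.zpowers x : Subgroup G) : Set G) := by
      have : Q ⊔ Subgroup.zpowers x ≤ Subgroup.centralizer {y} := by
        rw [sup_le_iff, Subgroup.zpowers_le]
        refine ⟨fun u hu => ?_, Subgroup.mem_centralizer_singleton_iff.mpr hxy⟩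
        exact Subgroup.mem_centralizer_singleton_iff.mpr
          (Subgroup.mem_centralizer_iff.mp hyQ u hu)
      rw [Subgroup.mem_centralizer_iff]
      exact fun u hu => Subgroup.mem_centralizer_singleton_iff.mp (this hu)
    have hlt : Q < Q ⊔ Subgroup.zpowers x :=
      SetLike.lt_iff_le_and_exists.mpr ⟨le_sup_left, x,
        (le_sup_right : _ ≤ Q ⊔ Subgroup.zpowers x) (Subgroup.mem_zpowers x), hxQ⟩
    have hle : Q ⊔ Subgroup.zpowers x ≤ R := by
      rw [sup_le_iff, Subgroup.zpowers_le]
      exact ⟨hQR', Subgroup.mem_inf.mpr ⟨hxP, hxN⟩⟩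
    exact hy (congrArg (fun b => b.coeff ⟨y, hS⟩) (hvanish _ hlt hle))
  -- Lift `w` to `a` in the kernel of `Br_P`. If `w ≠ 0`, then `i a i c = i` for some `c`, and
  -- `Br_P` turns this into `0 = Br_P(i)`.
  have hw0 : w = 0 := by
    by_contra hw0
    obtain ⟨a, haP, haQ, ha0⟩ := exists_fixed_lift hP hlt w hfix hsupp
    let φ : fixedAlg k P →+* CentAlg k Q :=
      (brauerHom k hQp).comp (Subalgebra.inclusion
        (fun _ h => fixedAlg_anti hQP h : fixedAlg k P ≤ fixedAlg k Q)).toRingHom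
    have hφa : φ ⟨a, haP⟩ = w := haQ
    have hφi : φ i = β := rfl
    obtain ⟨c, hc⟩ := hi.exists_mul_mul_eq k φ (a := ⟨a, haP⟩)
      (by rw [hφa, hφi, hwβ]; exact hww) (by rw [hφa, hφi, hwβ, hβw])
      (by rw [hφa, hφi, hwβ]; exact hw0)
    have hψ := congrArg (brauerHom k hP) hc
    have hψa : brauerHom k hP ⟨a, haP⟩ = 0 := ha0
    rw [map_mul, map_mul, map_mul, hψa, mul_zero, zero_mul, zero_mul] at hψ
    exact hne P le_rfl hψ.symm
  rw [hwdef, sub_mul, one_mul, sub_eq_zero] at hw0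
  exact hw0.symm

include p in
/-- Two Brauer pairs below a Brauer pair with the same subgroup are equal. -/
theorem block_eq_of_le {X : Pair k G} (hX : X.IsBrauerPair p) {Q : Subgroup G}
    {f f' : CentAlg k Q} (hf : IsBlockIdempotent f) (hf' : IsBlockIdempotent f')
    (h : (⟨Q, f⟩ : Pair k G) ≤ X) (h' : (⟨Q, f'⟩ : Pair k G) ≤ X) : f = f' := by
  obtain ⟨i, hi, hassoc⟩ := exists_associated hX.1 hX.2
  have h1 := h.2 i hi hassoc
  exact hf.eq_of_mul_eq hf' h1.2 h1.1 (h'.2 i hi hassoc).1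

include p in
theorem Pair.eq_of_le {X Y Z : Pair k G} (hX : X.IsBrauerPair p) (hY : IsBlockIdempotent Y.elem)
    (hZ : IsBlockIdempotent Z.elem) (hYX : Y ≤ X) (hZX : Z ≤ X)
    (h : Y.subgroup = Z.subgroup) : Y = Z := by
  obtain ⟨Q, f⟩ := Y
  obtain ⟨Q', f'⟩ := Z
  obtain rfl : Q = Q' := h
  exact congrArg _ (block_eq_of_le hX hY hZ hYX hZX)

include p in
-- Compare `f` with the block `f'` that exists below `(P, e)`. For `i` associated to `(P, e)` and a
-- primitive `j` of `(kG)^R` below `i` associated to `(R, g)`, both blocks fix `Br_Q(j) ≠ 0`.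
theorem Pair.le_trans {X Y Z : Pair k G} (hX : X.IsBrauerPair p) (hY : IsBlockIdempotent Y.elem)
    (hZ : IsBlockIdempotent Z.elem) (hZY : Z ≤ Y) (hYX : Y ≤ X) : Z ≤ X := by
  obtain ⟨P, e⟩ := X
  obtain ⟨R, g⟩ := Y
  obtain ⟨Q, f⟩ := Z
  have hRP : R ≤ P := hYX.1
  have hQR : Q ≤ R := hZY.1
  have hPp : IsPGroup p P := hX.1
  have hRp := hPp.to_le hRP
  have hQp := hRp.to_le hQR
  obtain ⟨f', hf', hle⟩ := exists_block_le hPp hX.2 Q (hQR.trans hRP)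
  suffices f = f' by rwa [this]
  obtain ⟨i, hi, hassoc⟩ := exists_associated hPp hX.2
  have hiR := fixedAlg_anti hRP i.2
  obtain ⟨h1, h2⟩ := hYX.2 i hi hassoc
  dsimp only at h1 h2 hY hZ
  obtain ⟨j, hj, hij, hji, hassj⟩ := exists_primitive_associated hRp hY (a := ⟨i, hiR⟩)
    (Subtype.ext (congrArg Subtype.val hi.1 : (i : MonoidAlgebra k G) * i = i)) (by
      dsimp only
      rw [h1]
      exact h2)
  obtain ⟨h3, h4⟩ := hZY.2 j hj hassj
  refine hZ.eq_of_mul_eq hf' h4 h3 ?_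
  have h5 : f' * brauerMap Q (i : MonoidAlgebra k G) = brauerMap Q (i : MonoidAlgebra k G) :=
    (hle.2 i hi hassoc).1
  have h6 : (i : MonoidAlgebra k G) * j = j := congrArg Subtype.val hij
  dsimp only
  rw [← h6, brauerMap_mul hQp (fixedAlg_anti hQR hiR) (fixedAlg_anti hQR j.2), ← mul_assoc, h5]

include p in
theorem Pair.le_of_le_of_le {X Y Z : Pair k G} (hX : X.IsBrauerPair p)
    (hY : IsBlockIdempotent Y.elem) (hZ : IsBlockIdempotent Z.elem) (hYX : Y ≤ X) (hZX : Z ≤ X)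
    (h : Y.subgroup ≤ Z.subgroup) : Y ≤ Z := by
  obtain ⟨f, hf, hle⟩ := exists_block_le (hX.1.to_le hZX.1) hZ Y.subgroup h
  have h1 : (⟨Y.subgroup, f⟩ : Pair k G) ≤ X := Pair.le_trans hX hZ hf hle hZX
  rwa [Pair.eq_of_le hX hY hf hYX h1 rfl]

omit [Finite G] in
theorem Pair.le_refl (X : Pair k G) : X ≤ X := ⟨_root_.le_refl _, fun _ _ h => h⟩

end BrauerPairs

/-! ### The fusion system of a Brauer pair -/

section Fusion

variable {k : Type*} [Field k] {G : Type*} [Group G] [Finite G] {p : ℕ} [Fact p.Prime] [CharP k p]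

omit [Finite G] in
theorem Pair.conj_eq_self {X : Pair k G} {x : G} (hx : x ∈ X.subgroup) : X.conj x = X := by
  refine Pair.ext_centIncl ?_ ?_
  · exact Subgroup.mem_normalizer_iff_map_conj_eq.mp (Subgroup.le_normalizer hx)
  · rw [centIncl_conj_elem]
    exact centIncl_mem_fixedAlg _ _ x hx

include p in
theorem Pair.conj_mul_le {X Y Z : Pair k G} (hX : IsBlockIdempotent X.elem)
    (hY : IsBlockIdempotent Y.elem) (hZ : Z.IsBrauerPair p) {x y : G} (h : X.conj x ≤ Y)
    (h' : Y.conj y ≤ Z) : X.conj (y * x) ≤ Z := by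
  rw [Pair.conj_mul]
  exact Pair.le_trans hZ (Pair.isBlockIdempotent_conj hY y)
    (Pair.isBlockIdempotent_conj (Pair.isBlockIdempotent_conj hX x) y)
    (Pair.conj_le_conj h y) h'

include p in
/-- The category attached to a Brauer pair is a fusion system. -/
theorem isFusionSystem_fusionHom {X : Pair k G} (hX : X.IsBrauerPair p) :
    IsFusionSystem (fusionHom X) := by
  have hsub : ∀ Q : Subgroup X.subgroup, Q.map X.subgroup.subtype ≤ X.subgroup := fun Q =>
    Subgroup.map_subtype_le Q
  have hex : ∀ Q : Subgroup X.subgroup, ∃ f, IsBlockBelow X (Q.map X.subgroup.subtype) f :=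
    fun Q => exists_block_le hX.1 hX.2 _ (hsub Q)
  have hpair : ∀ (Q : Subgroup X.subgroup) (f : CentAlg k (Q.map X.subgroup.subtype)),
      IsBlockIdempotent f → (⟨Q.map X.subgroup.subtype, f⟩ : Pair k G).IsBrauerPair p :=
    fun Q f hf => ⟨hX.1.to_le (hsub Q), hf⟩
  refine ⟨?_, ?_, ?_, ?_, ?_⟩
  · intro Q
    obtain ⟨f, hf⟩ := hex Q
    refine ⟨1, fun u => by simp, f, f, hf, hf, ?_⟩
    rw [Pair.conj_one]
    exact Pair.le_refl _
  · rintro Q R S φ ψ ⟨x, hx, f, g, hf, hg, hle⟩ ⟨y, hy, g', h, hg', hh, hle'⟩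
    refine ⟨y * x, fun u => ?_, f, h, hf, hh, ?_⟩
    · have h1 := hy (φ u)
      rw [hx u] at h1
      rw [MonoidHom.comp_apply, h1]
      simp only [mul_inv_rev, mul_assoc]
    -- The two morphisms come with their own blocks at `R`; uniqueness below `X` identifies them.
    · have hgg : g = g' := block_eq_of_le hX hg.1 hg'.1 hg.2 hg'.2
      rw [← hgg] at hle'
      exact Pair.conj_mul_le (X := ⟨_, f⟩) (Y := ⟨_, g⟩) (Z := ⟨_, h⟩) hf.1 hg.1
        (hpair S h hh.1) hle hle'
  · intro Q R φ x hx
    obtain ⟨f, hf⟩ := hex Q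
    obtain ⟨g, hg⟩ := hex R
    refine ⟨x, fun u => by rw [hx u]; rfl, f, g, hf, hg, ?_⟩
    -- Elements of `P` fix the pair `X`, so the conjugate of `(Q, e_Q)` is again below `X` and can
    -- be compared with `(R, e_R)` there.
    have h1 := Pair.conj_le_conj hf.2 (x : G)
    rw [Pair.conj_eq_self x.2] at h1
    have hf' := Pair.isBlockIdempotent_conj (X := ⟨_, f⟩) hf.1 (x : G)
    refine Pair.le_of_le_of_le (Z := ⟨_, g⟩) hX hf' hg.1 h1 hg.2 ?_
    rintro _ ⟨_, ⟨u, hu, rfl⟩, rfl⟩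
    refine ⟨φ ⟨u, hu⟩, (φ ⟨u, hu⟩).2, ?_⟩
    have h2 := hx ⟨u, hu⟩
    exact congrArg Subtype.val h2
  · rintro Q R φ ⟨x, hx, -⟩ u v huv
    have h1 := hx u
    rw [huv, hx v] at h1
    exact Subtype.ext (Subtype.ext (mul_left_cancel (mul_right_cancel h1)).symm)
  · rintro Q R φ ⟨x, hx, f, g, hf, hg, hle⟩
    have hinj : Function.Injective φ := by
      intro u v huv
      have h1 := hx u
      rw [huv, hx v] at h1
      exact Subtype.ext (Subtype.ext (mul_left_cancel (mul_right_cancel h1)).symm)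
    set T : Subgroup X.subgroup := φ.range.map R.subtype with hT
    let ψ : Q ≃* T := (MonoidHom.ofInjective hinj).trans
      (φ.range.equivMapOfInjective R.subtype R.subtype_injective)
    have hψ : ∀ u : Q, (ψ u : X.subgroup) = (φ u : X.subgroup) := fun u => rfl
    have hTmap : (Pair.conj x (⟨Q.map X.subgroup.subtype, f⟩ : Pair k G)).subgroup =
        T.map X.subgroup.subtype := by
      ext t
      constructor
      · rintro ⟨_, ⟨u, hu, rfl⟩, rfl⟩
        exact ⟨ψ ⟨u, hu⟩, (ψ ⟨u, hu⟩).2, by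
          change ((ψ ⟨u, hu⟩ : X.subgroup) : G) = x * (u : G) * x⁻¹
          rw [hψ, hx]⟩
      · rintro ⟨t, ht, rfl⟩
        obtain ⟨u, hu⟩ := ψ.surjective ⟨t, ht⟩
        refine ⟨(u : X.subgroup), ⟨u, u.2, rfl⟩, ?_⟩
        change x * ((u : X.subgroup) : G) * x⁻¹ = t
        rw [← hx, ← hψ, hu]
    -- The conjugate of `(Q, e_Q)` is itself the pair below `X` at `φ(Q)`, so `x` and `x⁻¹` realize
    -- `ψ` and its inverse with equality of pairs.
    obtain ⟨f', hf'⟩ : ∃ f' : CentAlg k (T.map X.subgroup.subtype),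
        Pair.conj x ⟨Q.map X.subgroup.subtype, f⟩ = ⟨T.map X.subgroup.subtype, f'⟩ := by
      rw [← hTmap]
      exact ⟨_, rfl⟩
    have hblock := Pair.isBlockIdempotent_conj (X := ⟨_, f⟩) hf.1 x
    rw [hf'] at hblock hle
    have hbelow : IsBlockBelow X (T.map X.subgroup.subtype) f' :=
      ⟨hblock, Pair.le_trans (Y := ⟨_, g⟩) (Z := ⟨_, f'⟩) hX hg.1 hblock hle hg.2⟩
    refine ⟨ψ, hψ, ⟨x, fun u => ?_, f, f', hf, hbelow, ?_⟩,
      ⟨x⁻¹, fun t => ?_, f', f, hbelow, hf, ?_⟩⟩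
    · exact (congrArg Subtype.val (hψ u)).trans (hx u)
    · rw [hf']
      exact Pair.le_refl _
    · obtain ⟨u, rfl⟩ := ψ.surjective t
      have h1 : ψ.symm.toMonoidHom (ψ u) = u := ψ.symm_apply_apply u
      rw [h1, hψ, hx]
      group
    · rw [← hf', Pair.conj_inv_conj]
      exact Pair.le_refl _

end Fusion

/-! ### Galois descent of block idempotents -/

section GaloisDescent

variable {K L : Type*} [Field K] [Field L] [Algebra K L] {H : Type*} [Group H]

theorem coeff_galConj (γ : L ≃ₐ[K] L) (a : MonoidAlgebra L H) (h : H) :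
    (galConj γ a).coeff h = γ (a.coeff h) := by
  simp [galConj]

/-- The Galois action on coefficients as a ring automorphism. -/
def galEquiv (γ : L ≃ₐ[K] L) : MonoidAlgebra L H ≃+* MonoidAlgebra L H where
  toFun := galConj γ
  invFun := galConj γ⁻¹
  left_inv a := by
    ext h
    rw [coeff_galConj, coeff_galConj]
    exact γ.symm_apply_apply _
  right_inv a := by
    ext h
    rw [coeff_galConj, coeff_galConj]
    exact γ.apply_symm_apply _
  map_mul' := map_mul (galConj γ)
  map_add' := map_add (galConj γ)

theorem galConj_galConj_inv (γ : L ≃ₐ[K] L) (a : MonoidAlgebra L H) :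
    galConj γ (galConj γ⁻¹ a) = a := (galEquiv γ).apply_symm_apply a

theorem galConj_one (a : MonoidAlgebra L H) : galConj (1 : L ≃ₐ[K] L) a = a := by
  ext h
  simp [coeff_galConj]

variable (K L) in
/-- Extension of scalars `KH → LH`. -/
abbrev scalarExt (H : Type*) [Group H] : MonoidAlgebra K H →+* MonoidAlgebra L H :=
  MonoidAlgebra.mapRingHom H (algebraMap K L)

theorem coeff_scalarExt (a : MonoidAlgebra K H) (h : H) :
    (scalarExt K L H a).coeff h = algebraMap K L (a.coeff h) := by
  simp [scalarExt]

theorem scalarExt_injective : Function.Injective (scalarExt K L H) := by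
  intro a b hab
  ext h
  apply (algebraMap K L).injective
  rw [← coeff_scalarExt, ← coeff_scalarExt, hab]

theorem galConj_scalarExt (γ : L ≃ₐ[K] L) (a : MonoidAlgebra K H) :
    galConj γ (scalarExt K L H a) = scalarExt K L H a := by
  ext h
  rw [coeff_galConj, coeff_scalarExt, AlgEquiv.commutes]

theorem IsBlockIdempotent.map_galConj {b : MonoidAlgebra L H} (hb : IsBlockIdempotent b)
    (γ : L ≃ₐ[K] L) : IsBlockIdempotent (galConj γ b) := hb.map_equiv (galEquiv γ)

variable [FiniteDimensional K L]

theorem galOrbitSum_induction {b : MonoidAlgebra L H} {x : MonoidAlgebra L H → MonoidAlgebra L H}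
    (hx : ∀ γ : L ≃ₐ[K] L, x (galConj γ b) = galConj γ b)
    (hadd : ∀ s : Finset (MonoidAlgebra L H), x (∑ c ∈ s, c) = ∑ c ∈ s, x c) :
    x (galOrbitSum K b) = galOrbitSum K b := by
  classical
  rw [galOrbitSum, hadd]
  refine Finset.sum_congr rfl fun c hc => ?_
  obtain ⟨γ, -, rfl⟩ := Finset.mem_image.mp hc
  exact hx γ

/-- A Galois invariant element which acts as the identity on `b` does so on the orbit sum. -/
theorem mul_galOrbitSum_of_mul_eq {b a : MonoidAlgebra L H}
    (ha : ∀ γ : L ≃ₐ[K] L, galConj γ a = a) (h : a * b = b) :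
    a * galOrbitSum K b = galOrbitSum K b :=
  galOrbitSum_induction (x := fun y => a * y) (fun γ => by
    conv_lhs => rw [← ha γ]
    rw [← map_mul, h]) fun s => Finset.mul_sum _ _ _

theorem mul_galOrbitSum_of_mul_eq_zero {b a : MonoidAlgebra L H}
    (ha : ∀ γ : L ≃ₐ[K] L, galConj γ a = a) (h : b * a = 0) : galOrbitSum K b * a = 0 := by
  classical
  rw [galOrbitSum, Finset.sum_mul]
  refine Finset.sum_eq_zero fun c hc => ?_
  obtain ⟨γ, -, rfl⟩ := Finset.mem_image.mp hc
  rw [← ha γ, ← map_mul, h, map_zero]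

theorem galOrbitSum_mul_self {b : MonoidAlgebra L H} (hb : IsBlockIdempotent b) :
    galOrbitSum K b * b = b := by
  classical
  rw [galOrbitSum, Finset.sum_mul, Finset.sum_eq_single b, hb.isIdempotentElem]
  · intro c hc hcb
    obtain ⟨γ, -, rfl⟩ := Finset.mem_image.mp hc
    exact (hb.map_galConj γ).mul_eq_zero hb hcb
  · intro h
    exact absurd (Finset.mem_image.mpr ⟨1, Finset.mem_univ _, galConj_one b⟩) h

/-- The orbit sum of `c` fixes `c`, whereas that of `b` kills any block not conjugate to `b`. -/
theorem exists_galConj_eq {b c : MonoidAlgebra L H} (hb : IsBlockIdempotent b)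
    (hc : IsBlockIdempotent c) (h : galOrbitSum K b = galOrbitSum K c) :
    ∃ γ : L ≃ₐ[K] L, galConj γ b = c := by
  classical
  have h1 := galOrbitSum_mul_self (K := K) hc
  by_contra! hne
  apply hc.ne_zero
  rw [← h1, ← h, galOrbitSum, Finset.sum_mul]
  refine Finset.sum_eq_zero fun d hd => ?_
  obtain ⟨γ, -, rfl⟩ := Finset.mem_image.mp hd
  exact (hb.map_galConj γ).mul_eq_zero hc (hne γ)

variable [IsGalois K L]

theorem scalarExt_tilde_mul_self {b : MonoidAlgebra L H} (hb : IsBlockIdempotent b) :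
    scalarExt K L H (tilde K b) * b = b := by
  rw [tilde_spec, galOrbitSum_mul_self hb]

theorem tilde_comm {b : MonoidAlgebra L H} (hb : IsBlockIdempotent b) (a : MonoidAlgebra K H) :
    tilde K b * a = a * tilde K b := by
  classical
  apply scalarExt_injective (L := L)
  rw [map_mul, map_mul, tilde_spec, galOrbitSum, Finset.sum_mul, Finset.mul_sum]
  refine Finset.sum_congr rfl fun c hc => ?_
  obtain ⟨γ, -, rfl⟩ := Finset.mem_image.mp hc
  exact (hb.map_galConj γ).comm _

/-- The sum of the Galois conjugates of a block idempotent of `LH` is a block idempotent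
of `KH`. -/
theorem isBlockIdempotent_tilde {b : MonoidAlgebra L H} (hb : IsBlockIdempotent b) :
    IsBlockIdempotent (tilde K b) := by
  classical
  rw [isBlockIdempotent_iff]
  refine ⟨tilde_comm hb, ?_, ?_, fun z hz hzz => ?_⟩
  · apply scalarExt_injective (L := L)
    rw [map_mul, tilde_spec]
    exact mul_galOrbitSum_of_mul_eq (galConj_galOrbitSum K · b) (galOrbitSum_mul_self hb)
  · intro h0
    apply hb.ne_zero
    rw [← scalarExt_tilde_mul_self (K := K) hb, h0, map_zero, zero_mul]
  -- `LH` is spanned over its central scalars `L` by `H`, so central elements of `KH` stay central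
  -- in `LH`.
  · have hcomm : ∀ a, scalarExt K L H z * a = a * scalarExt K L H z := by
      intro a
      induction a using MonoidAlgebra.induction_linear with
      | zero => simp
      | add f g hf hg => rw [mul_add, add_mul, hf, hg]
      | single h r =>
        have h1 : MonoidAlgebra.single h r =
            MonoidAlgebra.single 1 r * scalarExt K L H (MonoidAlgebra.single h 1) := by
          simp
        have h2 : scalarExt K L H z * MonoidAlgebra.single 1 r =
            MonoidAlgebra.single 1 r * scalarExt K L H z := by
          ext g
          rw [MonoidAlgebra.coeff_mul_single_one, MonoidAlgebra.coeff_single_one_mul, mul_comm]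
        rw [h1, ← mul_assoc, h2, mul_assoc, ← map_mul, hz, map_mul, mul_assoc]
    have hfix := fun γ : L ≃ₐ[K] L => galConj_scalarExt γ z
    refine (hb.mul_eq_zero_or_eq hcomm (hzz.map _)).imp (fun h => ?_) fun h => ?_
    · apply scalarExt_injective (L := L)
      rw [map_mul, tilde_spec, map_zero, hcomm]
      exact mul_galOrbitSum_of_mul_eq_zero hfix (by rw [← hcomm, h])
    · apply scalarExt_injective (L := L)
      rw [map_mul, tilde_spec]
      exact mul_galOrbitSum_of_mul_eq hfix h

/-- A block idempotent of `KH` which does not annihilate `b` is the sum of the conjugates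
of `b`. -/
theorem eq_tilde_of_mul_ne_zero {c : MonoidAlgebra K H} (hc : IsBlockIdempotent c)
    {b : MonoidAlgebra L H} (hb : IsBlockIdempotent b) (h : scalarExt K L H c * b ≠ 0) :
    c = tilde K b := by
  refine hc.eq_of_mul_ne_zero (isBlockIdempotent_tilde hb) fun h0 => h ?_
  rw [← scalarExt_tilde_mul_self (K := K) hb, ← mul_assoc, ← map_mul, h0, map_zero, zero_mul]

/-- The left side is a block of `KH'` that fixes the transported `b`, which determines it. -/
theorem tilde_mapDomainRingEquiv {H' : Type*} [Group H'] (φ : H ≃* H') {b : MonoidAlgebra L H}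
    (hb : IsBlockIdempotent b) : MonoidAlgebra.mapDomainRingEquiv K φ (tilde K b) =
      tilde K (MonoidAlgebra.mapDomainRingEquiv L φ b) := by
  have hb' := hb.map_equiv (MonoidAlgebra.mapDomainRingEquiv L φ)
  refine eq_tilde_of_mul_ne_zero ((isBlockIdempotent_tilde hb).map_equiv _) hb' ?_
  have h1 : scalarExt K L H' (MonoidAlgebra.mapDomainRingEquiv K φ (tilde K b)) =
      MonoidAlgebra.mapDomainRingEquiv L φ (scalarExt K L H (tilde K b)) := by
    ext h
    simp
  rw [h1, ← map_mul, scalarExt_tilde_mul_self hb]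
  exact hb'.ne_zero

end GaloisDescent

/-! ### Galois descent of Brauer pairs and of fusion -/

section BrauerPairDescent

variable {K L : Type*} [Field K] [Field L] [Algebra K L] {G : Type*} [Group G]

theorem brauerMap_scalarExt (P : Subgroup G) (a : MonoidAlgebra K G) :
    brauerMap P (scalarExt K L G a) = scalarExt K L _ (brauerMap P a) := by
  ext c
  rw [coeff_brauerMap, coeff_scalarExt, coeff_scalarExt, coeff_brauerMap]

theorem brauerMap_galConj (P : Subgroup G) (γ : L ≃ₐ[K] L) (a : MonoidAlgebra L G) :
    brauerMap P (galConj γ a) = galConj γ (brauerMap P a) := by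
  ext c
  rw [coeff_brauerMap, coeff_galConj, coeff_galConj, coeff_brauerMap]

theorem scalarExt_mem_fixedAlg {P : Subgroup G} {a : MonoidAlgebra K G}
    (ha : a ∈ fixedAlg K P) : scalarExt K L G a ∈ fixedAlg L P := by
  intro x hx
  ext g
  rw [coeff_conjAlg, coeff_scalarExt, coeff_scalarExt, ← coeff_conjAlg, ha x hx]

theorem galConj_mem_fixedAlg (γ : L ≃ₐ[K] L) {P : Subgroup G} {a : MonoidAlgebra L G}
    (ha : a ∈ fixedAlg L P) : galConj γ a ∈ fixedAlg L P := by
  intro x hx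
  ext g
  rw [coeff_conjAlg, coeff_galConj, coeff_galConj, ← coeff_conjAlg, ha x hx]

/-- The Galois action on the fixed point algebra `(LG)^P`. -/
def galFixed (γ : L ≃ₐ[K] L) (P : Subgroup G) : fixedAlg L P ≃+* fixedAlg L P where
  toFun a := ⟨galConj γ a.1, galConj_mem_fixedAlg γ a.2⟩
  invFun a := ⟨galConj γ⁻¹ a.1, galConj_mem_fixedAlg γ⁻¹ a.2⟩
  left_inv a := Subtype.ext ((galEquiv γ).symm_apply_apply a.1)
  right_inv a := Subtype.ext ((galEquiv γ).apply_symm_apply a.1)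
  map_mul' a b := Subtype.ext (map_mul (galConj γ) a.1 b.1)
  map_add' a b := Subtype.ext (map_add (galConj γ) a.1 b.1)

theorem Pair.associated_galConj (γ : L ≃ₐ[K] L) {P : Subgroup G} {e : CentAlg L P}
    {i : MonoidAlgebra L G} (h : (⟨P, e⟩ : Pair L G).Associated i) :
    (⟨P, galConj γ e⟩ : Pair L G).Associated (galConj γ i) := by
  unfold Pair.Associated at h ⊢
  dsimp only at h ⊢
  rw [brauerMap_galConj, ← map_mul, h.1]
  exact ⟨rfl, fun h0 => h.2 ((map_eq_zero_iff _ (galEquiv γ).injective).mp h0)⟩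

theorem Pair.galConj_le_galConj (γ : L ≃ₐ[K] L) {P Q : Subgroup G} {e : CentAlg L P}
    {f : CentAlg L Q} (h : (⟨Q, f⟩ : Pair L G) ≤ ⟨P, e⟩) :
    (⟨Q, galConj γ f⟩ : Pair L G) ≤ ⟨P, galConj γ e⟩ := by
  refine ⟨h.1, fun i hi hassoc => ?_⟩
  have h1 := Pair.associated_galConj γ⁻¹ hassoc
  have he : galConj γ⁻¹ (galConj γ e) = e := (galEquiv γ).symm_apply_apply e
  rw [he] at h1
  have h2 := Pair.associated_galConj γ (h.2 (galFixed γ⁻¹ P i) (hi.map_equiv _) h1)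
  have h3 : galConj γ ((galFixed γ⁻¹ P i : fixedAlg L P) : MonoidAlgebra L G) = i :=
    galConj_galConj_inv γ _
  rwa [h3] at h2

variable [Finite G] {p : ℕ} [Fact p.Prime]

theorem conjAlg_eq_self_of_comm {k : Type*} [Field k] {G : Type*} [Group G] {b : MonoidAlgebra k G}
    (hb : ∀ a, b * a = a * b) (x : G) : conjAlg k x b = b := by
  ext g
  have h := congrArg (fun a => a.coeff (g * x)) (hb (MonoidAlgebra.single x 1))
  simp only [MonoidAlgebra.coeff_mul_single_apply, MonoidAlgebra.coeff_single_mul_apply, mul_one,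
    one_mul, mul_inv_cancel_right] at h
  rw [coeff_conjAlg, mul_assoc, h]

/-- Membership of Brauer pairs in a block is inherited from smaller Brauer pairs. -/
theorem brauerMap_mul_of_le {k : Type*} [Field k] [CharP k p] {b : MonoidAlgebra k G}
    (hb : IsBlockIdempotent b) {X Y : Pair k G} (hX : X.IsBrauerPair p)
    (hYX : Y ≤ X) (hbY : brauerMap Y.subgroup b * Y.elem = Y.elem) :
    brauerMap X.subgroup b * X.elem = X.elem := by
  have hbfix : ∀ S : Subgroup G, b ∈ fixedAlg k S := fun S x _ =>
    conjAlg_eq_self_of_comm hb.comm x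
  obtain ⟨i, hi, hassoc⟩ := exists_associated hX.1 hX.2
  have hassY := hYX.2 i hi hassoc
  have hYp := hX.1.to_le hYX.1
  -- As `b` is a central idempotent and `i` is primitive, `bi` is `0` or `i`. If it were `0`, then
  -- `Br_Q(b)`, which fixes the block of `Y`, would kill `Br_Q(i)`, which that block fixes.
  have hbi : b * (i : MonoidAlgebra k G) = i := by
    have h := hi.map_mul_eq_zero_or_eq k (RingHom.id _) (a := ⟨b, hbfix _⟩)
      (Subtype.ext hb.isIdempotentElem) (Subtype.ext (hb.comm _))
    refine congrArg Subtype.val (h.resolve_left fun h0 => hassY.2 ?_)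
    have h0' : b * (i : MonoidAlgebra k G) = 0 := congrArg Subtype.val h0
    rw [← hassY.1, ← hbY, mul_assoc, hassY.1,
      ← brauerMap_mul hYp (hbfix _) (fixedAlg_anti hYX.1 i.2), h0', brauerMap_zero]
  refine (hX.2.mul_eq_zero_or_eq (fun c => ?_)
    (isIdempotentElem_brauerMap hX.1 (hbfix _) hb.isIdempotentElem)).resolve_left fun h0 => ?_
  · have hc := centIncl_mem_fixedAlg X.subgroup c
    rw [← brauerMap_centIncl X.subgroup c, ← brauerMap_mul hX.1 (hbfix _) hc,
      ← brauerMap_mul hX.1 hc (hbfix _), hb.comm]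
  · apply hassoc.2
    rw [← hbi, brauerMap_mul hX.1 (hbfix _) i.2, ← hassoc.1, ← mul_assoc, h0, zero_mul]

variable [CharP K p] [FiniteDimensional K L] [IsGalois K L]

include p in
/-- Inclusion of Brauer pairs is compatible with Galois descent. -/
theorem tilde_le_tilde {P Q : Subgroup G} (hP : IsPGroup p P) {e : CentAlg L P} {f : CentAlg L Q}
    (he : IsBlockIdempotent e) (hf : IsBlockIdempotent f) (h : (⟨Q, f⟩ : Pair L G) ≤ ⟨P, e⟩) :
    (⟨Q, tilde K f⟩ : Pair K G) ≤ ⟨P, tilde K e⟩ := by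
  have : CharP L p := charP_of_injective_algebraMap (algebraMap K L).injective p
  have hQP : Q ≤ P := h.1
  have hQp := hP.to_le hQP
  have het := isBlockIdempotent_tilde (K := K) he
  obtain ⟨g, hg, hle⟩ := exists_block_le hP het Q hQP
  suffices hgf : g = tilde K f by rwa [← hgf]
  obtain ⟨i, hi, hassoc⟩ := exists_associated hP het
  obtain ⟨hi3, -⟩ := hle.2 i hi hassoc
  obtain ⟨hi1, hi2⟩ := hassoc
  dsimp only at hi1 hi2 hi3
  set i' := scalarExt K L G (i : MonoidAlgebra K G)
  have hi' : i' ∈ fixedAlg L P := scalarExt_mem_fixedAlg i.2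
  have hii : (i : MonoidAlgebra K G) * i = i := congrArg Subtype.val hi.1
  have hii' : i' * i' = i' := by rw [← map_mul, hii]
  -- `Br_P(i')` is Galois invariant; if `e` killed it, so would all conjugates of `e` and hence `ẽ`.
  have hne : e * brauerMap P i' ≠ 0 := by
    intro h0
    apply hi2
    rw [← hi1]
    apply scalarExt_injective (L := L)
    rw [map_mul, tilde_spec, map_zero]
    refine mul_galOrbitSum_of_mul_eq_zero (fun γ => galConj_scalarExt γ _) ?_
    rwa [← brauerMap_scalarExt]
  -- `i'` may decompose over `L`. A primitive summand `j` associated to `(P, e)` links both sides: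
  -- `f` fixes `Br_Q(j)`, and `g` fixes `Br_Q(i')`, hence also `Br_Q(j)`.
  obtain ⟨j, hj, hij, -, hassj⟩ := exists_primitive_associated hP he (a := ⟨i', hi'⟩)
    (Subtype.ext hii') hne
  obtain ⟨hj1, hj2⟩ := h.2 j hj hassj
  dsimp only at hj1 hj2
  refine eq_tilde_of_mul_ne_zero hg hf fun h0 => hj2 ?_
  have hij' : i' * (j : MonoidAlgebra L G) = j := congrArg Subtype.val hij
  have h1 : scalarExt K L _ g * brauerMap Q i' = brauerMap Q i' := by
    rw [brauerMap_scalarExt, ← map_mul, hi3]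
  have h2 : scalarExt K L _ g * brauerMap Q (j : MonoidAlgebra L G) =
      brauerMap Q (j : MonoidAlgebra L G) := by
    rw [← hij', brauerMap_mul hQp (fixedAlg_anti hQP hi') (fixedAlg_anti hQP j.2), ← mul_assoc, h1]
  rw [← h2, ← hj1, ← mul_assoc, h0, zero_mul]

include p in
-- `Br_P(b̃) e = Br_P(b̃ b) e = Br_P(b) e = e`, and Galois invariance of `Br_P(b̃)` passes this on
-- to `ẽ`.
theorem tilde_mem_brauerPairs {b : MonoidAlgebra L G} (hb : IsBlockIdempotent b) {P : Subgroup G}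
    {e : CentAlg L P} (h : (⟨P, e⟩ : Pair L G) ∈ brauerPairs p b) :
    (⟨P, tilde K e⟩ : Pair K G) ∈ brauerPairs p (tilde K b) := by
  have : CharP L p := charP_of_injective_algebraMap (algebraMap K L).injective p
  obtain ⟨⟨hP, he⟩, hbe⟩ := h
  dsimp only at hP he hbe
  refine ⟨⟨hP, isBlockIdempotent_tilde he⟩, ?_⟩
  dsimp only
  have hbfix : b ∈ fixedAlg L P := fun x _ => conjAlg_eq_self_of_comm hb.comm x
  have hbfix' : tilde K b ∈ fixedAlg K P := fun x _ => conjAlg_eq_self_of_comm (tilde_comm hb) x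
  apply scalarExt_injective (L := L)
  rw [map_mul, tilde_spec]
  refine mul_galOrbitSum_of_mul_eq (fun γ => galConj_scalarExt γ _) ?_
  rw [← brauerMap_scalarExt]
  nth_rewrite 1 [← hbe]
  rw [← mul_assoc, ← brauerMap_mul hP (scalarExt_mem_fixedAlg hbfix') hbfix,
    scalarExt_tilde_mul_self hb, hbe]

include p in
-- A pair above `(P, ẽ)` is `(R, ẽ')` for some block `e'` over `L`. The block `f` below `e'` at `P`
-- satisfies `f̃ = ẽ`, so it is conjugate to `e`; applying that conjugation to `e'` gives a pair
-- above `(P, e)` in the block `b`, whence `R ≤ P`.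
theorem isMaximalBrauerPair_tilde {b : MonoidAlgebra L G} (hb : IsBlockIdempotent b)
    {P : Subgroup G} {e : CentAlg L P} (he : IsMaximalBrauerPair p b ⟨P, e⟩) :
    IsMaximalBrauerPair p (tilde K b) ⟨P, tilde K e⟩ := by
  have : CharP L p := charP_of_injective_algebraMap (algebraMap K L).injective p
  obtain ⟨hmem, hmax⟩ := he
  refine ⟨tilde_mem_brauerPairs hb hmem, ?_⟩
  rintro ⟨R, u⟩ ⟨hRu, -⟩ hle
  obtain ⟨⟨hP, heb⟩, hbe⟩ := hmem
  have hR : IsPGroup p R := hRu.1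
  have hu : IsBlockIdempotent u := hRu.2
  dsimp only at hP heb hbe
  have hPR : P ≤ R := hle.1
  obtain ⟨e', he', hne⟩ := exists_block_mul_ne_zero (A := CentAlg L R) L (i := scalarExt K L _ u)
    (fun h0 => hu.ne_zero (scalarExt_injective (L := L) (by rw [h0, map_zero])))
  rw [he'.comm] at hne
  obtain rfl := eq_tilde_of_mul_ne_zero hu he' hne
  obtain ⟨f, hf, hfle⟩ := exists_block_le hR he' P hPR
  have heq : tilde K f = tilde K e := block_eq_of_le hRu (isBlockIdempotent_tilde hf)
    (isBlockIdempotent_tilde heb) (tilde_le_tilde hR he' hf hfle) hle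
  obtain ⟨γ, rfl⟩ := exists_galConj_eq (K := K) hf heb (by rw [← tilde_spec, heq, tilde_spec])
  have hle' := Pair.galConj_le_galConj γ hfle
  have hBr : (⟨R, galConj γ e'⟩ : Pair L G).IsBrauerPair p := ⟨hR, he'.map_galConj γ⟩
  have hRP := (hmax ⟨hBr, brauerMap_mul_of_le hb hBr hle' hbe⟩ hle').1
  exact Pair.le_of_le_of_le hRu hu (isBlockIdempotent_tilde heb) (Pair.le_refl _) hle hRP

include p in
-- The same `x` works: the tilde construction respects the three inclusions of pairs and commutes
-- with conjugation.
theorem fusionHom_subset_fusionHom_tilde {P : Subgroup G} (hP : IsPGroup p P) {e : CentAlg L P}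
    (he : IsBlockIdempotent e) (Q R : Subgroup P) :
    fusionHom ⟨P, e⟩ Q R ⊆ fusionHom (⟨P, tilde K e⟩ : Pair K G) Q R := by
  rintro φ ⟨x, hx, f, g, hf, hg, hle⟩
  refine ⟨x, hx, tilde K f, tilde K g,
    ⟨isBlockIdempotent_tilde hf.1, tilde_le_tilde hP he hf.1 hf.2⟩,
    ⟨isBlockIdempotent_tilde hg.1, tilde_le_tilde hP he hg.1 hg.2⟩, ?_⟩
  have hR : IsPGroup p (R.map P.subtype) := hP.to_le (Subgroup.map_subtype_le R)
  rw [Pair.conj_mk] at hle ⊢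
  rw [tilde_mapDomainRingEquiv _ hf.1]
  exact tilde_le_tilde hR hg.1 (hf.1.map_equiv _) hle

end BrauerPairDescent

end BlockFusion

end

theorem corollary4p4 {p : ℕ} [Fact p.Prime] {K L : Type*} [Field K] [Field L] [CharP K p]
    [Algebra K L] [FiniteDimensional K L] [IsGalois K L] {G : Type*} [Group G] [Finite G]
    (b : MonoidAlgebra L G) (hb : BlockFusion.IsBlockIdempotent b)
    (P : Subgroup G) (e : BlockFusion.CentAlg L P)
    (he : BlockFusion.IsMaximalBrauerPair p b ⟨P, e⟩) :
    BlockFusion.IsBlockIdempotent (BlockFusion.tilde K b) ∧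
    BlockFusion.IsMaximalBrauerPair p (BlockFusion.tilde K b) ⟨P, BlockFusion.tilde K e⟩ ∧
    BlockFusion.IsFusionSystem (BlockFusion.fusionHom ⟨P, e⟩) ∧
    BlockFusion.IsFusionSystem
      (BlockFusion.fusionHom (⟨P, BlockFusion.tilde K e⟩ : BlockFusion.Pair K G)) ∧
    ∀ Q R : Subgroup P,
      BlockFusion.fusionHom ⟨P, e⟩ Q R ⊆
        BlockFusion.fusionHom (⟨P, BlockFusion.tilde K e⟩ : BlockFusion.Pair K G) Q R := by
  have : CharP L p := charP_of_injective_algebraMap (algebraMap K L).injective p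
  have hmax := BlockFusion.isMaximalBrauerPair_tilde (K := K) hb he
  exact ⟨BlockFusion.isBlockIdempotent_tilde hb, hmax,
    BlockFusion.isFusionSystem_fusionHom he.1.1, BlockFusion.isFusionSystem_fusionHom hmax.1.1,
    BlockFusion.fusionHom_subset_fusionHom_tilde he.1.1.1 he.1.1.2⟩
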